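/- **Setting.** Orders arrive at a warehouse according to a Poisson process $N(t)$ of rate $\lambda>0$ (integer-valued, $N(0)=0$, nondecreasing right-continuous paths, independent increments, increments over an interval of length $t$ Poisson with mean $\lambda t$). Fix a target load $q_H\in\{1,2,\dots\}$, a time limit $T_H>0$ and an order-up-to level $Q_H\in\{1,2,\dots\}$. Under the hybrid policy a dispatch is made as soon as $q_H$ orders have accumulated since the last dispatch (the first cycle starts at time $0$) or $T_H$ time units have elapsed since then, whichever is first. At a dispatch let $L$ be the size of the waiting load and $I$ the inventory on hand. If $I<L$, a quantity $Q_H+L-I$ is ordered and received at once and the load is dispatched, which leaves $Q_H$ units on hand; if $I\ge L$, the load is dispatched from stock, which leaves $I-L$ units. At time $0$ there are $Q_H$ units on hand and no orders waiting. A replenishment cycle is the time between two successive replenishments (the first one starts at time $0$). Each replenishment costs $A_R$ plus $c_R$ per unit, each dispatch costs $A_D$ plus $c_D$ per unit, inventory costs $h$ per unit per time unit, and waiting orders cost $\omega$ per order per time unit. Let $C(t)$ be the total cost incurred during $[0,t]$, and for $n\ge1$ let $L^R_n$ be the length of, and $TCost_n$ the total cost incurred during, the $n$-th replenishment cycle.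 Let $Y$ be Poisson with mean $\lambda T_H$ and $Y_{q_H}=\min(Y,q_H)$, with probability mass function $g_H$ and distribution function $G_H$; let $g_H^{(k)}$ be the $k$-fold convolution of $g_H$ (with $g_H^{(0)}$ the unit mass at $0$) and $G_H^{(k)}(i)=\sum_{j=0}^{i}g_H^{(k)}(j)$ the distribution function of that convolution. Put $$m_{g_H}(i)=\sum_{k=0}^{\infty}g_H^{(k)}(i),\qquad M_{G}(i)=\sum_{k=0}^{\infty}G_H^{(k)}(i).$$ **Statement.** These series converge for all integers $i\ge0$, $\mathbb E[Y_{q_H}]>0$ and $M_G(Q_H)>0$. For every $n$, $L^R_n$ and $TCost_n$ are integrable and $\mathbb E[L^R_n]>0$; for every $t\ge 0$, $C(t)$ is integrable. The expected long-run average cost per time unit exists, is the ratio of the expected cost to the expected length of a replenishment cycle, and is given by $$\lim_{t\to\infty}\frac{\mathbb E[C(t)]}{t}=\frac{\mathbb E[TCost_n]}{\mathbb E[L^R_n]}=\lambda(c_R+c_D)+\frac{\lambda A_R}{M_G(Q_H)\,\mathbb E[Y_{q_H}]}+\frac{\lambda A_D}{\mathbb E[Y_{q_H}]}+\frac{h\sum_{i=0}^{Q_H}(Q_H-i)\,m_{g_H}(i)}{M_G(Q_H)}+\frac{\omega\,\mathbb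 E[Y_{q_H}(Y_{q_H}-1)]}{2\,\mathbb E[Y_{q_H}]}\qquad(n\ge1).$$ -/

import Mathlib

open MeasureTheory ProbabilityTheory Filter Topology
open scoped NNReal

noncomputable section

/-! ### Demand -/

/-- `N` is a Poisson process of rate `r` under `P`: a counting process (it starts at `0` and has
nondecreasing right-continuous paths with values in `ℕ`) with independent increments, whose
increments over intervals of length `t` are Poisson distributed with mean `r * t`. -/
structure IsPoissonProcess {Ω : Type*} [MeasurableSpace Ω] (N : ℝ≥0 → Ω → ℕ) (r : ℝ≥0)
    (P : Measure Ω) : Prop where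
  measurable : ∀ t, Measurable (N t)
  zero : ∀ ω, N 0 ω = 0
  mono : ∀ ω, Monotone fun t => N t ω
  rightCont : ∀ ω t, ContinuousWithinAt (fun s => N s ω) (Set.Ici t) t
  indepIncrements : HasIndepIncrements N P
  law_increment : ∀ s t : ℝ≥0,
    HasLaw (fun ω => N (s + t) ω - N s ω) (poissonMeasure (r * t)) P

/-! ### The hybrid policy along a demand path

`q` is the target load, `T` the time limit, `Q` the order-up-to level and `n t` the cumulative
demand up to time `t`.  Consolidation cycles are numbered from `0`: cycle `k` is the time between
dispatch `k` and dispatch `k + 1`, where "dispatch `0`" stands for the start of operation. -/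

/-- The time of dispatch `k`.  Dispatch `k + 1` takes place at the first time at which the load
accumulated since dispatch `k` has reached `q` or `T` time units have elapsed since then; that is,
cycle `k` has length `min τ T` with `τ` the time needed to accumulate `q` orders. -/
def dispatchTime (q : ℕ) (T : ℝ≥0) (n : ℝ≥0 → ℕ) : ℕ → ℝ≥0
  | 0 => 0
  | k + 1 => sInf {t | dispatchTime q T n k ≤ t ∧
      (n (dispatchTime q T n k) + q ≤ n t ∨ dispatchTime q T n k + T ≤ t)}

/-- The size of the load accumulated in cycle `k`, which is released at dispatch `k + 1`. -/
def cycleLoad (q : ℕ) (T : ℝ≥0) (n : ℝ≥0 → ℕ) (k : ℕ) : ℕ :=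
  n (dispatchTime q T n (k + 1)) - n (dispatchTime q T n k)

/-- The inventory on hand during cycle `k`.  If at the end of the cycle it does not suffice to
clear the load, then stock is replenished so that `Q` units remain after the dispatch; otherwise
the load is dispatched from stock. -/
def onHand (q : ℕ) (T : ℝ≥0) (Q : ℕ) (n : ℝ≥0 → ℕ) : ℕ → ℕ
  | 0 => Q
  | k + 1 =>
      if onHand q T Q n k < cycleLoad q T n k then Q
      else onHand q T Q n k - cycleLoad q T n k

/-- The number of dispatches in the time interval `(0, t]`. -/
def dispatchCount (q : ℕ) (T : ℝ≥0) (n : ℝ≥0 → ℕ) (t : ℝ≥0) : ℕ :=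
  sSup {k : ℕ | dispatchTime q T n k ≤ t}

/-- The inventory level `I(t)`. -/
def inventoryLevel (q : ℕ) (T : ℝ≥0) (Q : ℕ) (n : ℝ≥0 → ℕ) (t : ℝ≥0) : ℕ :=
  onHand q T Q n (dispatchCount q T n t)

/-- The size `L(t)` of the consolidated load waiting at time `t`. -/
def waitingLoad (q : ℕ) (T : ℝ≥0) (n : ℝ≥0 → ℕ) (t : ℝ≥0) : ℕ :=
  n t - n (dispatchTime q T n (dispatchCount q T n t))

/-- The cost parameters: fixed and per-unit replenishment cost, fixed and per-unit dispatch cost,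
holding cost per unit per time unit, waiting cost per order per time unit. -/
structure CostParams where
  AR : ℝ
  cR : ℝ
  AD : ℝ
  cD : ℝ
  h : ℝ
  w : ℝ

/-- The lump-sum cost incurred at dispatch `k + 1`: the dispatch cost and, if the inventory does
not suffice to clear the load, the cost of replenishing `Q + load - inventory` units. -/
def dispatchCost (c : CostParams) (q : ℕ) (T : ℝ≥0) (Q : ℕ) (n : ℝ≥0 → ℕ) (k : ℕ) : ℝ :=
  c.AD + c.cD * (cycleLoad q T n k : ℝ) +
    if onHand q T Q n k < cycleLoad q T n k then
      c.AR + c.cR * ((Q : ℝ) + (cycleLoad q T n k : ℝ) - (onHand q T Q n k : ℝ))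
    else 0

/-- The total cost incurred in the time interval `[0, t]`. -/
def totalCost (c : CostParams) (q : ℕ) (T : ℝ≥0) (Q : ℕ) (n : ℝ≥0 → ℕ) (t : ℝ≥0) : ℝ :=
  (∑ k ∈ Finset.range (dispatchCount q T n t), dispatchCost c q T Q n k) +
    c.h * (∫ s in (0 : ℝ)..t, (inventoryLevel q T Q n s.toNNReal : ℝ)) +
    c.w * (∫ s in (0 : ℝ)..t, (waitingLoad q T n s.toNNReal : ℝ))

/-- The number of dispatches up to and including the one at which the `m`-th replenishment takes
place (`0` for `m = 0`); replenishment cycle `m` runs from the `m`-th replenishment (the start of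
operation if `m = 0`) to the `(m + 1)`-st one. -/
def replenishIndex (q : ℕ) (T : ℝ≥0) (Q : ℕ) (n : ℝ≥0 → ℕ) : ℕ → ℕ
  | 0 => 0
  | m + 1 =>
      sInf {k : ℕ | replenishIndex q T Q n m ≤ k ∧ onHand q T Q n k < cycleLoad q T n k} + 1

/-- The time of the `m`-th replenishment. -/
def replenishTime (q : ℕ) (T : ℝ≥0) (Q : ℕ) (n : ℝ≥0 → ℕ) (m : ℕ) : ℝ≥0 :=
  dispatchTime q T n (replenishIndex q T Q n m)

/-- The length of replenishment cycle `m`. -/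
def replenishCycleLength (q : ℕ) (T : ℝ≥0) (Q : ℕ) (n : ℝ≥0 → ℕ) (m : ℕ) : ℝ :=
  (replenishTime q T Q n (m + 1) : ℝ) - (replenishTime q T Q n m : ℝ)

/-- The total cost incurred during replenishment cycle `m`. -/
def replenishCycleCost (c : CostParams) (q : ℕ) (T : ℝ≥0) (Q : ℕ) (n : ℝ≥0 → ℕ) (m : ℕ) : ℝ :=
  totalCost c q T Q n (replenishTime q T Q n (m + 1)) -
    totalCost c q T Q n (replenishTime q T Q n m)

/-! ### The truncated Poisson distribution and its renewal functions

`Y` is Poisson with mean `μ` and `Y_q = min Y q`. -/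

/-- `E[Y_q]`. -/
def truncMean (μ : ℝ≥0) (q : ℕ) : ℝ :=
  ∫ y, ((min y q : ℕ) : ℝ) ∂(poissonMeasure μ)

/-- `E[Y_q (Y_q - 1)]`. -/
def truncFactorialMoment (μ : ℝ≥0) (q : ℕ) : ℝ :=
  ∫ y, ((min y q : ℕ) : ℝ) * (((min y q : ℕ) : ℝ) - 1) ∂(poissonMeasure μ)

/-- The probability mass function `g` of `Y_q`. -/
def truncPMF (μ : ℝ≥0) (q i : ℕ) : ℝ :=
  (poissonMeasure μ).real {y | min y q = i}

/-- The `k`-fold convolution `g^(k)`, with `g^(0)` the unit mass at `0`. -/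
def convPMF (μ : ℝ≥0) (q : ℕ) : ℕ → ℕ → ℝ
  | 0, i => if i = 0 then 1 else 0
  | k + 1, i => ∑ j ∈ Finset.range (i + 1), convPMF μ q k j * truncPMF μ q (i - j)

/-- The distribution function `G^(k)` of the `k`-fold convolution. -/
def convCDF (μ : ℝ≥0) (q k i : ℕ) : ℝ :=
  ∑ j ∈ Finset.range (i + 1), convPMF μ q k j

/-- The renewal mass function `m_g(i) = ∑_{k ≥ 0} g^(k)(i)`. -/
def renewalMass (μ : ℝ≥0) (q i : ℕ) : ℝ :=
  ∑' k, convPMF μ q k i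

/-- The renewal function `M_G(i) = ∑_{k ≥ 0} G^(k)(i)`. -/
def renewalFun (μ : ℝ≥0) (q i : ℕ) : ℝ :=
  ∑' k, convCDF μ q k i

end

/-! Replenishment cycles are never shown to be i.i.d., and no renewal theorem is used. The proof
follows the stock on hand at successive dispatches, solves a Poisson equation for it, and stops the
resulting mean-zero sums at suitable dispatches.

One consolidation cycle. Almost surely the demand has unit jumps (`ae_hasUnitJumps`), so a cycle
cannot overshoot `q` and its load is `min Y q`, with `Y` the demand in the `T` time units after the
dispatch (`cycleLoad_eq_min`). By the strong Markov property (`setIntegral_increment_of_stopping`)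
this `Y` is Poisson and independent of the past. The length of the cycle and the waiting time in it
are integrals over the fixed interval `[0, T]` of functions of the demand since the dispatch. Fubini
and the identity `d/dx E[F(Y_x)] = E[F(Y_x + 1) - F(Y_x)]`, with `Y_x` Poisson of mean `x`, give
their means `E[Y_q] / r` and `E[Y_q (Y_q - 1)] / (2 r)`.

The Poisson equation. `M_G` solves `M(i) = 1 + ∑ g(y) M(i - y)`, and its sum function `R(i) = ∑_{j <
i} M(j)` solves `R(i) = i + ∑ g(y) R(i - y)`. The first reflects a unit charge per dispatch, the
second a charge equal to the stock. A combination of the two and a linear term, `potential`, makes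
the cost of a cycle, minus `averageCost` times its length, minus the change of the potential, a
variable of mean zero given the past (`integral_oneStep`, `setIntegral_cycleCost_sub`).

Stopping. Summing over the cycles before a nonanticipating index `κ` with `∑ P(k < κ)` finite gives
(`integral_sum_cycleCost`) `E[cost before κ] = averageCost * E[time of dispatch κ] + E[potential at
κ] - potential at Q`. For `κ` the first dispatch after `t`, all errors are bounded, so `E[C(t)] =
averageCost * t + O(1)`. For `κ` the index of the `m`-th replenishment, the stock is `Q` and the
potential terms cancel, so expected cost and expected time are exactly proportional; differences in
`m` give the ratio for each cycle. Summability comes from a pathwise bound on the number of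
dispatches in the first case, and in the second from the mean-zero identity itself, applied to
artificial costs (`summable_replenishCount_lt`). -/

/-! ### Dispatch times and loads along a single demand path -/

section Path

variable {q : ℕ} {T : ℝ≥0} {Q : ℕ} {n : ℝ≥0 → ℕ}

/-- A demand path: nondecreasing and right-continuous. -/
structure IsDemandPath (n : ℝ≥0 → ℕ) : Prop where
  mono : Monotone n
  rightCont : ∀ t, ContinuousWithinAt n (Set.Ici t) t

/-- `ℕ` is discrete, so right-continuity means being constant on a short interval to the right. -/
theorem IsDemandPath.exists_right_const (hn : IsDemandPath n) (t : ℝ≥0) :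
    ∃ u, t < u ∧ ∀ s, t ≤ s → s < u → n s = n t := by
  have h := hn.rightCont t
  have h2 : ∀ᶠ s in 𝓝[≥] t, n s = n t := by
    exact h.eventually (show {n t} ∈ 𝓝 (n t) by simp)
  obtain ⟨u, hu, hs⟩ := mem_nhdsGE_iff_exists_Ico_subset.1 h2
  exact ⟨u, hu, fun s h1 h2 => hs ⟨h1, h2⟩⟩

/-- The set whose infimum is taken is upward closed, and by right-continuity it contains its
infimum. This equivalence is the working description of dispatch times from here on. -/
theorem dispatchTime_succ_le_iff (hn : IsDemandPath n) (k : ℕ) (t : ℝ≥0) :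
    dispatchTime q T n (k + 1) ≤ t ↔ dispatchTime q T n k ≤ t ∧
      (n (dispatchTime q T n k) + q ≤ n t ∨ dispatchTime q T n k + T ≤ t) := by
  set d := dispatchTime q T n k with hd
  set S : Set ℝ≥0 := {t | d ≤ t ∧ (n d + q ≤ n t ∨ d + T ≤ t)} with hS
  have hdef : dispatchTime q T n (k + 1) = sInf S := rfl
  have hne : S.Nonempty := ⟨d + T, by simp [hS]⟩
  have hup : ∀ s ∈ S, ∀ t, s ≤ t → t ∈ S := by
    rintro s ⟨h1, h2⟩ t hst
    refine ⟨h1.trans hst, ?_⟩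
    rcases h2 with h2 | h2
    · exact Or.inl (h2.trans (hn.mono hst))
    · exact Or.inr (h2.trans hst)
  have hmem : sInf S ∈ S := by
    have h1 : d ≤ sInf S := le_csInf hne fun t ht => ht.1
    refine ⟨h1, ?_⟩
    by_contra! hcon
    obtain ⟨u, hu, hconst⟩ := hn.exists_right_const (sInf S)
    obtain ⟨t, htS, htu⟩ := exists_lt_of_csInf_lt hne (lt_min hu hcon.2)
    have hle : sInf S ≤ t := csInf_le (OrderBot.bddBelow _) htS
    have := hconst t hle (htu.trans_le (min_le_left _ _))
    rcases htS.2 with h | h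
    · omega
    · exact absurd (htu.trans_le (min_le_right _ _)) (not_lt.2 h)
  rw [hdef]
  constructor
  · intro h
    exact hup _ hmem t h
  · intro h
    exact csInf_le (OrderBot.bddBelow _) h

theorem dispatchTime_lt_succ (hn : IsDemandPath n) (hq : 0 < q) (hT : 0 < T) (k : ℕ) :
    dispatchTime q T n k < dispatchTime q T n (k + 1) := by
  obtain ⟨h1, h2⟩ := (dispatchTime_succ_le_iff (q := q) (T := T) hn k _).1 le_rfl
  refine lt_of_le_of_ne h1 fun h => ?_
  rw [← h] at h2
  rcases h2 with h2 | h2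
  · omega
  · exact absurd h2 (not_le.2 (lt_add_of_pos_right _ hT))

theorem dispatchTime_succ_le_add (hn : IsDemandPath n) (k : ℕ) :
    dispatchTime q T n (k + 1) ≤ dispatchTime q T n k + T :=
  (dispatchTime_succ_le_iff hn k _).2 ⟨le_self_add, Or.inr le_rfl⟩

theorem dispatchTime_strictMono (hn : IsDemandPath n) (hq : 0 < q) (hT : 0 < T) :
    StrictMono (dispatchTime q T n) :=
  strictMono_nat_of_lt_succ (dispatchTime_lt_succ hn hq hT)

/-- Every cycle uses up either `q ≥ 1` orders or `T` time units, so dispatches cannot accumulate in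
finite time. -/
theorem nat_le_of_dispatchTime (hn : IsDemandPath n) (hq : 0 < q) (hT : 0 < T) (k : ℕ) :
    (k : ℝ) ≤ n (dispatchTime q T n k) + (dispatchTime q T n k : ℝ) / T := by
  have hT' : (0 : ℝ) < T := by exact_mod_cast hT
  induction k with
  | zero => simp; positivity
  | succ k ih =>
    obtain ⟨h1, h2⟩ := (dispatchTime_succ_le_iff (q := q) (T := T) hn k _).1 le_rfl
    have h3 := hn.mono h1
    set d := dispatchTime q T n k
    set d' := dispatchTime q T n (k + 1)
    have h1' : (d : ℝ) / T ≤ d' / T := by gcongr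
    push_cast
    rcases h2 with h2 | h2
    · have : (n d : ℝ) + 1 ≤ n d' := by exact_mod_cast (by omega : n d + 1 ≤ n d')
      linarith
    · have h3' : (n d : ℝ) ≤ n d' := by exact_mod_cast h3
      have : ((d : ℝ) + T) / T ≤ d' / T := by
        gcongr; exact_mod_cast h2
      rw [add_div, div_self hT'.ne'] at this
      linarith

theorem nat_le_of_dispatchTime_le (hn : IsDemandPath n) (hq : 0 < q) (hT : 0 < T) {k : ℕ}
    {t : ℝ≥0} (h : dispatchTime q T n k ≤ t) : (k : ℝ) ≤ n t + (t : ℝ) / T := by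
  refine (nat_le_of_dispatchTime hn hq hT k).trans ?_
  have : (n (dispatchTime q T n k) : ℝ) ≤ n t := by exact_mod_cast hn.mono h
  gcongr

/-- The supremum of an unbounded set of naturals would be the default value `0`; the preceding bound
excludes this, so the count is a true maximum. -/
theorem le_dispatchCount_iff (hn : IsDemandPath n) (hq : 0 < q) (hT : 0 < T) {k : ℕ}
    {t : ℝ≥0} : k ≤ dispatchCount q T n t ↔ dispatchTime q T n k ≤ t := by
  have hb : BddAbove {k : ℕ | dispatchTime q T n k ≤ t} := by
    refine ⟨⌊(n t + (t : ℝ) / T)⌋₊, fun k hk => ?_⟩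
    exact Nat.le_floor (nat_le_of_dispatchTime_le hn hq hT hk)
  constructor
  · intro h
    have hmem : dispatchCount q T n t ∈ {k : ℕ | dispatchTime q T n k ≤ t} :=
      Nat.sSup_mem ⟨0, by simp [dispatchTime]⟩ hb
    exact ((dispatchTime_strictMono hn hq hT).monotone h).trans hmem
  · intro h
    exact le_csSup hb h

theorem dispatchCount_le (hn : IsDemandPath n) (hq : 0 < q) (hT : 0 < T) (t : ℝ≥0) :
    (dispatchCount q T n t : ℝ) ≤ n t + (t : ℝ) / T :=
  nat_le_of_dispatchTime_le hn hq hT ((le_dispatchCount_iff hn hq hT).1 le_rfl)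

theorem lt_dispatchTime_dispatchCount_succ (hn : IsDemandPath n) (hq : 0 < q) (hT : 0 < T)
    (t : ℝ≥0) : t < dispatchTime q T n (dispatchCount q T n t + 1) := by
  by_contra! h
  have := (le_dispatchCount_iff hn hq hT).2 h
  omega

theorem dispatchCount_eq (hn : IsDemandPath n) (hq : 0 < q) (hT : 0 < T) {k : ℕ} {t : ℝ≥0}
    (h1 : dispatchTime q T n k ≤ t) (h2 : t < dispatchTime q T n (k + 1)) :
    dispatchCount q T n t = k := by
  have h3 := (le_dispatchCount_iff hn hq hT).2 h1
  have h4 : ¬ (k + 1 ≤ dispatchCount q T n t) := fun h =>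
    absurd ((le_dispatchCount_iff hn hq hT).1 h) (not_le.2 h2)
  omega

theorem add_lt_dispatchTime_succ_iff (hn : IsDemandPath n) (k : ℕ) (s : ℝ≥0) :
    dispatchTime q T n k + s < dispatchTime q T n (k + 1) ↔
      n (dispatchTime q T n k + s) - n (dispatchTime q T n k) < q ∧ s < T := by
  have h1 := dispatchTime_succ_le_iff (q := q) (T := T) hn k (dispatchTime q T n k + s)
  have h2 := hn.mono (le_self_add : dispatchTime q T n k ≤ dispatchTime q T n k + s)
  rw [← not_le, h1]
  simp only [le_add_iff_nonneg_right, zero_le, true_and, not_or, not_le, add_lt_add_iff_left]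
  have : n (dispatchTime q T n k + s) < n (dispatchTime q T n k) + q ↔
      n (dispatchTime q T n k + s) - n (dispatchTime q T n k) < q := by omega
  rw [this]

/-- The length of consolidation cycle `k`. -/
noncomputable def cycleLength (q : ℕ) (T : ℝ≥0) (n : ℝ≥0 → ℕ) (k : ℕ) : ℝ :=
  (dispatchTime q T n (k + 1) : ℝ) - dispatchTime q T n k

/-- The demand during the first `s` time units after dispatch `k`. -/
noncomputable def demandAfter (q : ℕ) (T : ℝ≥0) (n : ℝ≥0 → ℕ) (k : ℕ) (s : ℝ≥0) : ℕ :=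
  n (dispatchTime q T n k + s) - n (dispatchTime q T n k)

theorem cycleLength_nonneg (hn : IsDemandPath n) (k : ℕ) : 0 ≤ cycleLength q T n k :=
  sub_nonneg.2 (NNReal.coe_le_coe.2 ((dispatchTime_succ_le_iff hn k _).1 le_rfl).1)

theorem cycleLength_le (hn : IsDemandPath n) (k : ℕ) : cycleLength q T n k ≤ T := by
  have := NNReal.coe_le_coe.2 (dispatchTime_succ_le_add (q := q) (T := T) hn k)
  push_cast at this
  unfold cycleLength
  linarith

/-- At age `s < T` the cycle is still running exactly when fewer than `q` orders have come. The
random upper limit thus becomes the fixed limit `T`, and only increments over deterministic lengths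
after the dispatch remain. -/
theorem integral_demandAfter_lt (hn : IsDemandPath n) (k : ℕ) (φ : ℝ → ℝ) :
    ∫ s in (0 : ℝ)..T, (if demandAfter q T n k s.toNNReal < q then φ s else 0) =
      ∫ s in (0 : ℝ)..cycleLength q T n k, φ s := by
  have hl := cycleLength_le (q := q) (T := T) hn k
  have hl0 := cycleLength_nonneg (q := q) (T := T) hn k
  set l := cycleLength q T n k with hl_def
  rw [intervalIntegral.integral_of_le T.coe_nonneg, intervalIntegral.integral_of_le hl0,
    ← integral_Ico_eq_integral_Ioc, ← integral_Ico_eq_integral_Ioc]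
  have : Set.Ico (0 : ℝ) l = Set.Ico (0 : ℝ) T ∩ Set.Iio l := by
    ext x; simp only [Set.mem_Ico, Set.mem_inter_iff, Set.mem_Iio]
    constructor
    · rintro ⟨h1, h2⟩; exact ⟨⟨h1, h2.trans_le hl⟩, h2⟩
    · rintro ⟨⟨h1, h2⟩, h3⟩; exact ⟨h1, h3⟩
  rw [this, ← setIntegral_indicator measurableSet_Iio]
  refine setIntegral_congr_fun measurableSet_Ico fun s hs => ?_
  have hiff := add_lt_dispatchTime_succ_iff (q := q) (T := T) hn k s.toNNReal
  have hsT : s.toNNReal < T := (Real.toNNReal_lt_iff_lt_coe hs.1).2 hs.2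
  have h2 : dispatchTime q T n k + s.toNNReal < dispatchTime q T n (k + 1) ↔ s < l := by
    rw [← NNReal.coe_lt_coe, NNReal.coe_add, Real.coe_toNNReal _ hs.1, hl_def, cycleLength]
    constructor <;> intro h <;> linarith
  have h3 : demandAfter q T n k s.toNNReal < q ↔ s < l := by
    rw [← h2, hiff]; simp [demandAfter, hsT]
  by_cases h : s < l
  · simp [Set.indicator, h, h3.2 h]
  · simp [Set.indicator, h, mt h3.1 h]

/-- The path makes no jump larger than `1`. -/
def HasUnitJumps (n : ℝ≥0 → ℕ) : Prop :=
  ∀ K : ℕ, ∃ m : ℕ, 0 < m ∧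
    ∀ j < K * m, n (((j + 1 : ℕ) : ℝ≥0) / m) ≤ n ((j : ℝ≥0) / m) + 1

/-- In the grid cell `(j / m, (j + 1) / m]` containing `t`, the left endpoint precedes `t`, so the
path is below `a` there and rises by at most `1` across the cell. -/
theorem HasUnitJumps.le_add_of_forall_lt (hj : HasUnitJumps n) (hn : IsDemandPath n) {a : ℕ}
    {t : ℝ≥0} (ht : 0 < t) (h : ∀ s < t, n s < a) : n t ≤ a := by
  obtain ⟨K, hK⟩ := exists_nat_ge t
  obtain ⟨m, hm, hjm⟩ := hj K
  have hm' : (0 : ℝ≥0) < m := by exact_mod_cast hm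
  obtain ⟨j, hj⟩ : ∃ j, ⌈t * m⌉₊ = j + 1 :=
    ⟨⌈t * m⌉₊ - 1, by have := Nat.ceil_pos.2 (mul_pos ht hm'); omega⟩
  have h1 : t ≤ ((j + 1 : ℕ) : ℝ≥0) / m := by
    rw [le_div_iff₀ hm', ← hj]; exact Nat.le_ceil _
  have h2 : (j : ℝ≥0) / m < t := by
    rw [div_lt_iff₀ hm']
    exact Nat.lt_ceil.1 (by omega)
  have h3 : j < K * m := by
    have : ⌈t * m⌉₊ ≤ K * m := Nat.ceil_le.2 (by push_cast; gcongr)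
    omega
  have := hn.mono h1
  have := hjm j h3
  have := h _ h2
  omega

theorem apply_dispatchTime_succ_le (hn : IsDemandPath n) (hj : HasUnitJumps n) (hq : 0 < q)
    (hT : 0 < T) (k : ℕ) :
    n (dispatchTime q T n (k + 1)) ≤ n (dispatchTime q T n k) + q := by
  refine hj.le_add_of_forall_lt hn (zero_le.trans_lt (dispatchTime_lt_succ hn hq hT k)) ?_
  intro s hs
  by_contra! hc
  rcases le_total (dispatchTime q T n k) s with h | h
  · exact absurd ((dispatchTime_succ_le_iff hn k s).2 ⟨h, Or.inl hc⟩) (not_le.2 hs)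
  · have := hn.mono h
    omega

theorem cycleLoad_le (hn : IsDemandPath n) (hj : HasUnitJumps n) (hq : 0 < q)
    (hT : 0 < T) (k : ℕ) : cycleLoad q T n k ≤ q := by
  have := apply_dispatchTime_succ_le hn hj hq hT k
  unfold cycleLoad
  omega

/-- If the cycle ends by the load, both sides equal `q`, since there is no overshoot; if it ends by
the clock, the dispatch is exactly `T` later. The load thus depends only on a fixed-length
increment. -/
theorem cycleLoad_eq_min (hn : IsDemandPath n) (hj : HasUnitJumps n) (hq : 0 < q)
    (hT : 0 < T) (k : ℕ) : cycleLoad q T n k = min (demandAfter q T n k T) q := by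
  have h1 := apply_dispatchTime_succ_le hn hj hq hT k
  have h2 := dispatchTime_succ_le_add (q := q) (T := T) hn k
  have h3 := hn.mono h2
  obtain ⟨h4, h5⟩ := (dispatchTime_succ_le_iff (q := q) (T := T) hn k _).1 le_rfl
  unfold cycleLoad demandAfter
  rcases h5 with h5 | h5
  · omega
  · rw [le_antisymm h2 h5] at h1 ⊢
    omega

theorem onHand_le (k : ℕ) : onHand q T Q n k ≤ Q := by
  induction k with
  | zero => exact le_rfl
  | succ k ih =>
    rw [onHand]
    split_ifs
    · exact le_rfl
    · omega

end Path

/-! ### Cost as a sum over consolidation cycles -/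

section Cost

variable {q : ℕ} {T : ℝ≥0} {Q : ℕ} {n : ℝ≥0 → ℕ} {c : CostParams}

/-- The total waiting time of the orders that arrive in consolidation cycle `k`. -/
noncomputable def cycleWaiting (q : ℕ) (T : ℝ≥0) (n : ℝ≥0 → ℕ) (k : ℕ) : ℝ :=
  ∫ s in (0 : ℝ)..T, if demandAfter q T n k s.toNNReal < q then
    (demandAfter q T n k s.toNNReal : ℝ) else 0

/-- The cost incurred in consolidation cycle `k`, including the dispatch at its end. -/
noncomputable def cycleCost (c : CostParams) (q : ℕ) (T : ℝ≥0) (Q : ℕ) (n : ℝ≥0 → ℕ) (k : ℕ) : ℝ :=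
  dispatchCost c q T Q n k + c.h * (onHand q T Q n k * cycleLength q T n k) +
    c.w * cycleWaiting q T n k

theorem demandAfter_mono (hn : IsDemandPath n) (k : ℕ) : Monotone (demandAfter q T n k) :=
  fun _ _ h => Nat.sub_le_sub_right (hn.mono (by gcongr)) _

/-- Stock and load are constant in form on `[d_k, d_{k+1})` and change at the right endpoint, while
interval integrals run over half-open intervals containing that endpoint; it is a null set. -/
theorem intervalIntegral_congr_of_Ico {f g : ℝ → ℝ} {a b : ℝ} (hab : a ≤ b)
    (hfg : ∀ s ∈ Set.Ico a b, f s = g s) (hg : IntervalIntegrable g volume a b) :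
    IntervalIntegrable f volume a b ∧ ∫ s in a..b, f s = ∫ s in a..b, g s := by
  rw [intervalIntegrable_iff_integrableOn_Ico_of_le hab] at hg ⊢
  rw [intervalIntegral.integral_of_le hab, intervalIntegral.integral_of_le hab,
    ← integral_Ico_eq_integral_Ioc, ← integral_Ico_eq_integral_Ioc]
  exact ⟨hg.congr_fun (fun s hs => (hfg s hs).symm) measurableSet_Ico,
    setIntegral_congr_fun measurableSet_Ico hfg⟩

theorem inventoryLevel_waitingLoad_eq (hn : IsDemandPath n) (hq : 0 < q) (hT : 0 < T) (k : ℕ)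
    {s : ℝ} (h1 : (dispatchTime q T n k : ℝ) ≤ s) (h2 : s < dispatchTime q T n (k + 1)) :
    inventoryLevel q T Q n s.toNNReal = onHand q T Q n k ∧
      waitingLoad q T n s.toNNReal =
        demandAfter q T n k (s - dispatchTime q T n k).toNNReal := by
  have hD := dispatchCount_eq hn hq hT (k := k) (t := s.toNNReal)
    (NNReal.le_toNNReal_of_coe_le h1)
    ((Real.toNNReal_lt_iff_lt_coe (le_trans (NNReal.coe_nonneg _) h1)).2 h2)
  have hs : dispatchTime q T n k + (s - dispatchTime q T n k).toNNReal = s.toNNReal := by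
    rw [← NNReal.coe_inj, NNReal.coe_add, Real.coe_toNNReal _ (sub_nonneg.2 h1),
      Real.coe_toNNReal _ (le_trans (NNReal.coe_nonneg _) h1)]
    ring
  rw [inventoryLevel, waitingLoad, hD, demandAfter, hs]
  exact ⟨rfl, rfl⟩

/-- The endpoint `u` may lie inside the cycle, so that the unfinished cycle at time `t` is covered
as well as complete ones. -/
theorem integral_piece (hn : IsDemandPath n) (hq : 0 < q) (hT : 0 < T) (k : ℕ) {u : ℝ}
    (h1 : (dispatchTime q T n k : ℝ) ≤ u) (h2 : u ≤ dispatchTime q T n (k + 1)) :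
    IntervalIntegrable (fun s : ℝ => (inventoryLevel q T Q n s.toNNReal : ℝ)) volume
      (dispatchTime q T n k) u ∧
    ∫ s in (dispatchTime q T n k : ℝ)..u, (inventoryLevel q T Q n s.toNNReal : ℝ) =
      onHand q T Q n k * (u - dispatchTime q T n k) ∧
    IntervalIntegrable (fun s : ℝ => (waitingLoad q T n s.toNNReal : ℝ)) volume
      (dispatchTime q T n k) u ∧
    ∫ s in (dispatchTime q T n k : ℝ)..u, (waitingLoad q T n s.toNNReal : ℝ) =
      ∫ s in (0 : ℝ)..(u - dispatchTime q T n k), (demandAfter q T n k s.toNNReal : ℝ) := by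
  have e := fun s (hs : s ∈ Set.Ico (dispatchTime q T n k : ℝ) u) =>
    inventoryLevel_waitingLoad_eq (Q := Q) hn hq hT k hs.1 (hs.2.trans_le h2)
  obtain ⟨a1, a2⟩ := intervalIntegral_congr_of_Ico
    (f := fun s : ℝ => (inventoryLevel q T Q n s.toNNReal : ℝ))
    (g := fun _ => (onHand q T Q n k : ℝ)) h1
    (fun s hs => by simp only [(e s hs).1]) intervalIntegrable_const
  obtain ⟨b1, b2⟩ := intervalIntegral_congr_of_Ico
    (f := fun s : ℝ => (waitingLoad q T n s.toNNReal : ℝ))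
    (g := fun s => (demandAfter q T n k (s - dispatchTime q T n k).toNNReal : ℝ)) h1
    (fun s hs => by simp only [(e s hs).2])
    (Monotone.intervalIntegrable fun _ _ h => Nat.cast_le.2
      (demandAfter_mono hn k (Real.toNNReal_mono (by linarith))))
  refine ⟨a1, ?_, b1, ?_⟩
  · rw [a2, intervalIntegral.integral_const, smul_eq_mul, mul_comm]
  · rw [b2, intervalIntegral.integral_comp_sub_right
      (fun s : ℝ => (demandAfter q T n k s.toNNReal : ℝ)), sub_self]

theorem integral_upTo_dispatchTime (hn : IsDemandPath n) (hq : 0 < q) (hT : 0 < T) (k : ℕ) :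
    IntervalIntegrable (fun s : ℝ => (inventoryLevel q T Q n s.toNNReal : ℝ)) volume
      0 (dispatchTime q T n k) ∧
    ∫ s in (0 : ℝ)..(dispatchTime q T n k), (inventoryLevel q T Q n s.toNNReal : ℝ) =
      ∑ j ∈ Finset.range k, onHand q T Q n j * cycleLength q T n j ∧
    IntervalIntegrable (fun s : ℝ => (waitingLoad q T n s.toNNReal : ℝ)) volume
      0 (dispatchTime q T n k) ∧
    ∫ s in (0 : ℝ)..(dispatchTime q T n k), (waitingLoad q T n s.toNNReal : ℝ) =
      ∑ j ∈ Finset.range k, cycleWaiting q T n j := by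
  induction k with
  | zero => simp [dispatchTime]
  | succ k ih =>
    obtain ⟨i1, i2, i3, i4⟩ := ih
    obtain ⟨p1, p2, p3, p4⟩ := integral_piece (Q := Q) hn hq hT k
      (NNReal.coe_le_coe.2 (dispatchTime_lt_succ (T := T) hn hq hT k).le) le_rfl
    refine ⟨i1.trans p1, ?_, i3.trans p3, ?_⟩
    · rw [← intervalIntegral.integral_add_adjacent_intervals i1 p1, i2, p2,
        Finset.sum_range_succ, cycleLength]
    · rw [← intervalIntegral.integral_add_adjacent_intervals i3 p3, i4, p4,
        Finset.sum_range_succ, cycleWaiting,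
        integral_demandAfter_lt hn k fun s => (demandAfter q T n k s.toNNReal : ℝ), cycleLength]

theorem totalCost_eq (hn : IsDemandPath n) (hq : 0 < q) (hT : 0 < T) {k : ℕ} {t : ℝ≥0}
    (h1 : dispatchTime q T n k ≤ t) (h2 : t < dispatchTime q T n (k + 1)) :
    totalCost c q T Q n t = ∑ j ∈ Finset.range k, cycleCost c q T Q n j +
      c.h * (onHand q T Q n k * (t - dispatchTime q T n k)) +
      c.w * ∫ s in (0 : ℝ)..(t - dispatchTime q T n k), (demandAfter q T n k s.toNNReal : ℝ) := by
  obtain ⟨i1, i2, i3, i4⟩ := integral_upTo_dispatchTime (Q := Q) hn hq hT k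
  obtain ⟨p1, p2, p3, p4⟩ := integral_piece (Q := Q) hn hq hT k
    (NNReal.coe_le_coe.2 h1) (NNReal.coe_le_coe.2 h2.le)
  rw [totalCost, dispatchCount_eq hn hq hT h1 h2,
    ← intervalIntegral.integral_add_adjacent_intervals i1 p1,
    ← intervalIntegral.integral_add_adjacent_intervals i3 p3, i2, p2, i4, p4]
  simp only [cycleCost, Finset.sum_add_distrib, ← Finset.mul_sum]
  ring

theorem totalCost_dispatchTime (hn : IsDemandPath n) (hq : 0 < q) (hT : 0 < T) (k : ℕ) :
    totalCost c q T Q n (dispatchTime q T n k) =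
      ∑ j ∈ Finset.range k, cycleCost c q T Q n j := by
  rw [totalCost_eq hn hq hT le_rfl (dispatchTime_lt_succ hn hq hT k)]
  simp

theorem integral_demandAfter_le (hn : IsDemandPath n) (hj : HasUnitJumps n) (hq : 0 < q)
    (hT : 0 < T) (k : ℕ) {x : ℝ} (h0 : 0 ≤ x) (hx : x ≤ cycleLength q T n k) :
    |∫ s in (0 : ℝ)..x, (demandAfter q T n k s.toNNReal : ℝ)| ≤ q * T := by
  have hb : ∀ s ∈ Set.uIoc (0 : ℝ) x, ‖(demandAfter q T n k s.toNNReal : ℝ)‖ ≤ q := by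
    intro s hs
    rw [Set.uIoc_of_le h0] at hs
    have h1 : dispatchTime q T n k + s.toNNReal ≤ dispatchTime q T n (k + 1) := by
      rw [← NNReal.coe_le_coe, NNReal.coe_add, Real.coe_toNNReal _ hs.1.le]
      have := hs.2.trans hx
      rw [cycleLength] at this
      linarith
    have h2 := hn.mono h1
    have h3 := apply_dispatchTime_succ_le hn hj hq hT k
    rw [Real.norm_natCast, Nat.cast_le, demandAfter]
    omega
  have := intervalIntegral.norm_integral_le_of_norm_le_const hb
  rw [sub_zero, abs_of_nonneg h0] at this
  refine this.trans ?_
  have := hx.trans (cycleLength_le hn k)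
  gcongr

theorem cycleWaiting_eq (hn : IsDemandPath n) (k : ℕ) : cycleWaiting q T n k =
    ∫ s in (0 : ℝ)..cycleLength q T n k, (demandAfter q T n k s.toNNReal : ℝ) :=
  integral_demandAfter_lt hn k fun s => (demandAfter q T n k s.toNNReal : ℝ)

theorem abs_cycleWaiting_le (hn : IsDemandPath n) (hj : HasUnitJumps n) (hq : 0 < q)
    (hT : 0 < T) (k : ℕ) : |cycleWaiting q T n k| ≤ q * T := by
  rw [cycleWaiting_eq hn]
  exact integral_demandAfter_le hn hj hq hT k (cycleLength_nonneg hn k) le_rfl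

/-- A bound for the cost incurred in a consolidation cycle. -/
noncomputable def cycleCostBound (c : CostParams) (q : ℕ) (T : ℝ≥0) (Q : ℕ) : ℝ :=
  |c.AD| + |c.cD| * q + (|c.AR| + |c.cR| * (Q + q)) + |c.h| * (Q * T) + |c.w| * (q * T)

/-- With or without a replenishment, the quantity ordered is the load plus the change of the stock.
The unit cost `cR` therefore joins `cD` as a charge on the load, and the rest telescopes. -/
theorem dispatchCost_eq (k : ℕ) : dispatchCost c q T Q n k =
    c.AD + (c.cD + c.cR) * cycleLoad q T n k +
      c.AR * (if onHand q T Q n k < cycleLoad q T n k then 1 else 0) +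
      c.cR * ((onHand q T Q n (k + 1) : ℝ) - onHand q T Q n k) := by
  rw [dispatchCost, onHand]
  split_ifs with h
  · ring
  · rw [Nat.cast_sub (not_lt.1 h)]
    ring

theorem abs_dispatchCost_le (hL : cycleLoad q T n k ≤ q) :
    |dispatchCost c q T Q n k| ≤ |c.AD| + |c.cD| * q + (|c.AR| + |c.cR| * (Q + q)) := by
  have hL' : (cycleLoad q T n k : ℝ) ≤ q := by exact_mod_cast hL
  have hI : (onHand q T Q n k : ℝ) ≤ Q := by exact_mod_cast onHand_le k
  have hL0 : (0 : ℝ) ≤ cycleLoad q T n k := Nat.cast_nonneg _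
  have hI0 : (0 : ℝ) ≤ onHand q T Q n k := Nat.cast_nonneg _
  rw [dispatchCost]
  refine (abs_add_le _ _).trans (add_le_add ((abs_add_le _ _).trans ?_) ?_)
  · rw [abs_mul, abs_of_nonneg hL0]
    gcongr
  · split_ifs
    · refine (abs_add_le _ _).trans ?_
      rw [abs_mul]
      gcongr
      rw [abs_le]
      constructor <;> linarith
    · rw [abs_zero]; positivity

theorem abs_cycleCost_le (hn : IsDemandPath n) (hj : HasUnitJumps n) (hq : 0 < q)
    (hT : 0 < T) (k : ℕ) : |cycleCost c q T Q n k| ≤ cycleCostBound c q T Q := by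
  have hI : (onHand q T Q n k : ℝ) ≤ Q := by exact_mod_cast onHand_le k
  rw [cycleCost, cycleCostBound]
  refine (abs_add_le _ _).trans (add_le_add ((abs_add_le _ _).trans (add_le_add
    (abs_dispatchCost_le (cycleLoad_le hn hj hq hT k)) ?_)) ?_)
  · rw [abs_mul, abs_mul, Nat.abs_cast, abs_of_nonneg (cycleLength_nonneg hn k)]
    have := cycleLength_le (q := q) (T := T) hn k
    have := cycleLength_nonneg (q := q) (T := T) hn k
    gcongr
  · rw [abs_mul]
    gcongr
    exact abs_cycleWaiting_le hn hj hq hT k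

/-- The sum includes the whole cycle in progress at `t`, because "cycle `k` has started by `t`" is
known at dispatch `k`. One bound pays for that full cycle, the other for the holding and waiting
costs already incurred in it. -/
theorem abs_totalCost_sub_le (hn : IsDemandPath n) (hj : HasUnitJumps n) (hq : 0 < q)
    (hT : 0 < T) (t : ℝ≥0) :
    |totalCost c q T Q n t -
      ∑ j ∈ Finset.range (dispatchCount q T n t + 1), cycleCost c q T Q n j| ≤
      2 * cycleCostBound c q T Q := by
  set k := dispatchCount q T n t with hk
  have h1 : dispatchTime q T n k ≤ t := (le_dispatchCount_iff hn hq hT).1 le_rfl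
  have h2 := lt_dispatchTime_dispatchCount_succ hn hq hT t
  rw [← hk] at h2
  rw [totalCost_eq hn hq hT h1 h2, Finset.sum_range_succ]
  have hI : (onHand q T Q n k : ℝ) ≤ Q := by exact_mod_cast onHand_le k
  have hx0 : (0 : ℝ) ≤ t - dispatchTime q T n k := sub_nonneg.2 (NNReal.coe_le_coe.2 h1)
  have hx : (t : ℝ) - dispatchTime q T n k ≤ cycleLength q T n k := by
    have := NNReal.coe_lt_coe.2 h2
    rw [cycleLength]; linarith
  have hb := integral_demandAfter_le hn hj hq hT k hx0 hx
  have hxT := hx.trans (cycleLength_le hn k)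
  have a1 := abs_cycleCost_le (Q := Q) (c := c) hn hj hq hT k
  have a2 : |c.h * (onHand q T Q n k * (t - dispatchTime q T n k))| ≤ |c.h| * (Q * T) := by
    rw [abs_mul, abs_mul, Nat.abs_cast, abs_of_nonneg hx0]
    gcongr
  have a3 : |c.w * ∫ s in (0 : ℝ)..(t - dispatchTime q T n k),
      (demandAfter q T n k s.toNNReal : ℝ)| ≤ |c.w| * (q * T) := by
    rw [abs_mul]; gcongr
  have a4 : |c.h| * (Q * T) + |c.w| * (q * T) ≤ cycleCostBound c q T Q := by
    rw [cycleCostBound]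
    have : 0 ≤ |c.AD| + |c.cD| * q + (|c.AR| + |c.cR| * (Q + q)) := by positivity
    linarith
  rw [abs_le] at *
  constructor <;> linarith

end Cost

/-! ### Counting replenishments -/

section Replenishment

variable {q : ℕ} {T : ℝ≥0} {Q : ℕ} {n : ℝ≥0 → ℕ}

/-- The number of replenishments at the first `k` dispatches. -/
noncomputable def replenishCount (q : ℕ) (T : ℝ≥0) (Q : ℕ) (n : ℝ≥0 → ℕ) (k : ℕ) : ℕ :=
  ∑ j ∈ Finset.range k, if onHand q T Q n j < cycleLoad q T n j then 1 else 0

theorem replenishCount_succ (k : ℕ) : replenishCount q T Q n (k + 1) = replenishCount q T Q n k +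
    if onHand q T Q n k < cycleLoad q T n k then 1 else 0 :=
  Finset.sum_range_succ _ _

theorem replenishCount_mono : Monotone (replenishCount q T Q n) :=
  monotone_nat_of_le_succ fun k => by rw [replenishCount_succ]; omega

theorem exists_replenishment (hC : ∀ m, ∃ k, m ≤ replenishCount q T Q n k) (a : ℕ) :
    ∃ k, a ≤ k ∧ onHand q T Q n k < cycleLoad q T n k := by
  by_contra! h
  obtain ⟨k, hk⟩ := hC (replenishCount q T Q n a + 1)
  have : ∀ i, replenishCount q T Q n (a + i) = replenishCount q T Q n a := by
    intro i
    induction i with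
    | zero => rfl
    | succ i ih =>
      rw [← add_assoc, replenishCount_succ, ih, if_neg (not_lt.2 (h (a + i) (by omega)))]
      rfl
  have h1 := this k
  have h2 := replenishCount_mono (q := q) (T := T) (Q := Q) (n := n) (show k ≤ a + k by omega)
  omega

/-- The index is the first `k` at which the replenishment count reaches `m`, so `k < replenishIndex`
is decided by the first `k` cycles. Unboundedness of the count keeps the infima in the definition
from being taken over the empty set. -/
theorem lt_replenishIndex_iff (hC : ∀ m, ∃ k, m ≤ replenishCount q T Q n k) (m k : ℕ) :
    k < replenishIndex q T Q n m ↔ replenishCount q T Q n k < m := by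
  induction m generalizing k with
  | zero => simp [replenishIndex]
  | succ m ih =>
    set R := replenishIndex q T Q n m with hR
    -- The count moves by at most one per dispatch, so the level `m` is hit exactly.
    have hCR : replenishCount q T Q n R = m := by
      have h1 : m ≤ replenishCount q T Q n R := not_lt.1 ((ih R).not.1 (lt_irrefl R))
      refine le_antisymm ?_ h1
      rcases Nat.eq_zero_or_pos R with h | h
      · rw [h]; simp [replenishCount]
      · obtain ⟨r, hr⟩ := Nat.exists_eq_succ_of_ne_zero h.ne'
        have := (ih r).1 (by omega)
        rw [hr, Nat.succ_eq_add_one, replenishCount_succ]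
        split_ifs <;> omega
    set S := {k : ℕ | R ≤ k ∧ onHand q T Q n k < cycleLoad q T n k} with hS
    have hne : S.Nonempty := exists_replenishment hC R
    have hdef : replenishIndex q T Q n (m + 1) = sInf S + 1 := rfl
    rw [hdef, Nat.lt_succ_iff]
    constructor
    · intro h
      have hno : ∀ j, R ≤ j → j < k → ¬ onHand q T Q n j < cycleLoad q T n j :=
        fun j h1 h2 h3 => Nat.notMem_of_lt_sInf (h2.trans_le h) ⟨h1, h3⟩
      have : ∀ i, R + i ≤ k → replenishCount q T Q n (R + i) = m := by
        intro i
        induction i with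
        | zero => intro _; exact hCR
        | succ i ih2 =>
          intro hi
          rw [← add_assoc, replenishCount_succ, ih2 (by omega),
            if_neg (hno (R + i) (by omega) (by omega))]
          rfl
      rcases le_total R k with h1 | h1
      · have := this (k - R) (by omega)
        rw [Nat.add_sub_cancel' h1] at this
        omega
      · have := replenishCount_mono (q := q) (T := T) (Q := Q) (n := n) h1
        omega
    · intro h
      by_contra! hlt
      obtain ⟨h1, h2⟩ := Nat.sInf_mem hne
      have h3 := replenishCount_mono (q := q) (T := T) (Q := Q) (n := n) h1
      have h4 := replenishCount_mono (q := q) (T := T) (Q := Q) (n := n)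
        (Nat.succ_le_of_lt hlt)
      rw [Nat.succ_eq_add_one, replenishCount_succ, if_pos h2] at h4
      omega

theorem onHand_replenishIndex (hC : ∀ m, ∃ k, m ≤ replenishCount q T Q n k) (m : ℕ) :
    onHand q T Q n (replenishIndex q T Q n m) = Q := by
  cases m with
  | zero => rfl
  | succ m =>
    have := Nat.sInf_mem (s := {k : ℕ | replenishIndex q T Q n m ≤ k ∧
      onHand q T Q n k < cycleLoad q T n k}) (exists_replenishment hC _)
    rw [replenishIndex, onHand, if_pos this.2]

theorem replenishIndex_lt_succ (hC : ∀ m, ∃ k, m ≤ replenishCount q T Q n k) (m : ℕ) :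
    replenishIndex q T Q n m < replenishIndex q T Q n (m + 1) := by
  have := Nat.sInf_mem (s := {k : ℕ | replenishIndex q T Q n m ≤ k ∧
      onHand q T Q n k < cycleLoad q T n k}) (exists_replenishment hC _)
  rw [replenishIndex.eq_2]
  exact Nat.lt_succ_of_le this.1

end Replenishment

/-! ### Nonanticipation: dispatches up to `t` see only demand up to `t` -/

section Stopped

variable {q : ℕ} {T : ℝ≥0} {Q : ℕ} {n n' : ℝ≥0 → ℕ} {t : ℝ≥0}

/-- The dispatches up to time `t` depend only on the demand up to time `t`. -/
theorem dispatchTime_eq_of_eqOn (hn : IsDemandPath n) (hn' : IsDemandPath n')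
    (h : ∀ s ≤ t, n s = n' s) (k : ℕ) :
    (dispatchTime q T n k ≤ t ↔ dispatchTime q T n' k ≤ t) ∧
      (dispatchTime q T n k ≤ t → dispatchTime q T n k = dispatchTime q T n' k) := by
  have key : ∀ k, ∀ u ≤ t, dispatchTime q T n k ≤ u ↔ dispatchTime q T n' k ≤ u := by
    intro k
    induction k with
    | zero => simp [dispatchTime]
    | succ k ih =>
      intro u hu
      rw [dispatchTime_succ_le_iff hn, dispatchTime_succ_le_iff hn', ← ih u hu]
      refine and_congr_right fun hd => ?_
      have h1 : dispatchTime q T n k = dispatchTime q T n' k :=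
        le_antisymm ((ih _ ((((ih u hu).1 hd)).trans hu)).2 le_rfl)
          ((ih _ (hd.trans hu)).1 le_rfl)
      rw [← h1, h _ (hd.trans hu), h u hu]
  refine ⟨key k t le_rfl, fun hd => le_antisymm ?_ ?_⟩
  · exact (key k _ ((key k t le_rfl).1 hd)).2 le_rfl
  · exact (key k _ hd).1 le_rfl

theorem cycleLoad_eq_of_eqOn (hn : IsDemandPath n) (hn' : IsDemandPath n')
    (h : ∀ s ≤ t, n s = n' s) (k : ℕ) (hk : dispatchTime q T n (k + 1) ≤ t) :
    cycleLoad q T n k = cycleLoad q T n' k := by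
  have hk0 := ((dispatchTime_succ_le_iff hn k t).1 hk).1
  rw [cycleLoad, cycleLoad, ← (dispatchTime_eq_of_eqOn hn hn' h _).2 hk,
    ← (dispatchTime_eq_of_eqOn hn hn' h _).2 hk0, h _ hk, h _ hk0]

theorem onHand_replenishCount_eq_of_eqOn (hn : IsDemandPath n) (hn' : IsDemandPath n')
    (h : ∀ s ≤ t, n s = n' s) (k : ℕ) (hk : dispatchTime q T n k ≤ t) :
    onHand q T Q n k = onHand q T Q n' k ∧
      replenishCount q T Q n k = replenishCount q T Q n' k := by
  induction k with
  | zero => exact ⟨rfl, rfl⟩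
  | succ k ih =>
    obtain ⟨i1, i2⟩ := ih ((dispatchTime_succ_le_iff hn k t).1 hk).1
    rw [onHand, onHand, replenishCount_succ, replenishCount_succ, i1, i2,
      cycleLoad_eq_of_eqOn hn hn' h k hk]
    exact ⟨rfl, rfl⟩

/-- Freezing the path at `t` leaves a demand path that depends only on the past of `t`; this is how
events are shown to belong to that past. -/
theorem IsDemandPath.stopped (hn : IsDemandPath n) (t : ℝ≥0) :
    IsDemandPath fun s => n (min s t) where
  mono := fun _ _ h => hn.mono (min_le_min_right t h)
  rightCont := fun s => ContinuousWithinAt.comp (f := fun u => min u t)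
    (hn.rightCont (min s t)) (continuous_id.min continuous_const).continuousWithinAt
    fun _ hu => min_le_min_right t hu

end Stopped

/-! ### Measurability and the filtration of the demand -/

section Measurability

variable {Ω : Type*} {q : ℕ} {T : ℝ≥0} {Q : ℕ}

/-- The smallest multiple of `1 / (m + 1)` that is at least `s`. -/
noncomputable def gridAbove (m : ℕ) (s : ℝ≥0) : ℝ≥0 := (⌈s * (m + 1)⌉₊ : ℝ≥0) / (m + 1)

theorem le_gridAbove (m : ℕ) (s : ℝ≥0) : s ≤ gridAbove m s := by
  rw [gridAbove, le_div_iff₀ (by positivity)]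
  exact Nat.le_ceil _

theorem gridAbove_le (m : ℕ) (s : ℝ≥0) : gridAbove m s ≤ s + 1 / (m + 1) := by
  rw [gridAbove, div_le_iff₀ (by positivity), add_mul, one_div,
    inv_mul_cancel₀ (by positivity)]
  exact (Nat.ceil_lt_add_one zero_le).le

theorem tendsto_gridAbove (s : ℝ≥0) : Tendsto (fun m => gridAbove m s) atTop (𝓝[≥] s) := by
  refine tendsto_nhdsWithin_iff.2 ⟨?_, Eventually.of_forall fun m => le_gridAbove m s⟩
  refine tendsto_of_tendsto_of_tendsto_of_le_of_le tendsto_const_nhds ?_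
    (fun m => le_gridAbove m s) (fun m => gridAbove_le m s)
  have : Tendsto (fun m : ℕ => s + 1 / ((m : ℝ≥0) + 1)) atTop (𝓝 (s + 0)) :=
    tendsto_const_nhds.add (NNReal.tendsto_coe.1 (by
      push_cast
      exact tendsto_one_div_add_atTop_nhds_zero_nat))
  simpa using this

/-- Rounding the time up to a grid gives a countable choice of random variables, and
right-continuity passes to the limit. -/
theorem measurable_uncurry_of_rightCont [MeasurableSpace Ω] {N : ℝ≥0 → Ω → ℕ}
    (hm : ∀ t, Measurable (N t)) (hN : ∀ ω, IsDemandPath fun t => N t ω) :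
    Measurable fun p : ℝ≥0 × Ω => N p.1 p.2 := by
  refine measurable_of_tendsto_metrizable
    (f := fun m (p : ℝ≥0 × Ω) => N (gridAbove m p.1) p.2) (fun m => ?_) ?_
  · have h1 : Measurable fun p : ℕ × Ω => N ((p.1 : ℝ≥0) / (m + 1)) p.2 :=
      measurable_from_prod_countable_right fun j => hm ((j : ℝ≥0) / (m + 1))
    have h2 : Measurable fun p : ℝ≥0 × Ω => (⌈p.1 * (m + 1)⌉₊, p.2) :=
      (Nat.measurable_ceil.comp (by fun_prop)).prodMk measurable_snd
    exact h1.comp h2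
  · refine tendsto_pi_nhds.2 fun p => ?_
    exact ((hN p.2).rightCont p.1).tendsto.comp (tendsto_gridAbove p.1)

theorem measurable_eval [MeasurableSpace Ω] {N : ℝ≥0 → Ω → ℕ}
    (hm : ∀ t, Measurable (N t)) (hN : ∀ ω, IsDemandPath fun t => N t ω) {σ : Ω → ℝ≥0}
    (hσ : Measurable σ) : Measurable fun ω => N (σ ω) ω :=
  (measurable_uncurry_of_rightCont hm hN).comp (hσ.prodMk measurable_id)

theorem measurable_dispatchTime [MeasurableSpace Ω] {N : ℝ≥0 → Ω → ℕ}
    (hm : ∀ t, Measurable (N t)) (hN : ∀ ω, IsDemandPath fun t => N t ω) (k : ℕ) :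
    Measurable fun ω => dispatchTime q T (fun t => N t ω) k := by
  induction k with
  | zero => exact measurable_const
  | succ k ih =>
    refine measurable_of_Iic fun t => ?_
    have : (fun ω => dispatchTime q T (fun t => N t ω) (k + 1)) ⁻¹' Set.Iic t =
        {ω | dispatchTime q T (fun t => N t ω) k ≤ t} ∩
        ({ω | N (dispatchTime q T (fun t => N t ω) k) ω + q ≤ N t ω} ∪
          {ω | dispatchTime q T (fun t => N t ω) k + T ≤ t}) := by
      ext ω
      exact dispatchTime_succ_le_iff (hN ω) k t
    rw [this]
    exact (measurableSet_le ih measurable_const).inter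
      ((measurableSet_le ((measurable_eval hm hN ih).add_const q) (hm t)).union
        (measurableSet_le (ih.add_const T) measurable_const))

theorem measurable_cycleLoad [MeasurableSpace Ω] {N : ℝ≥0 → Ω → ℕ}
    (hm : ∀ t, Measurable (N t)) (hN : ∀ ω, IsDemandPath fun t => N t ω) (k : ℕ) :
    Measurable fun ω => cycleLoad q T (fun t => N t ω) k :=
  (measurable_eval hm hN (measurable_dispatchTime hm hN (k + 1))).sub
    (measurable_eval hm hN (measurable_dispatchTime hm hN k))

theorem measurable_onHand [MeasurableSpace Ω] {N : ℝ≥0 → Ω → ℕ}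
    (hm : ∀ t, Measurable (N t)) (hN : ∀ ω, IsDemandPath fun t => N t ω) (k : ℕ) :
    Measurable fun ω => onHand q T Q (fun t => N t ω) k := by
  induction k with
  | zero => exact measurable_const
  | succ k ih =>
    have hL := measurable_cycleLoad (q := q) (T := T) hm hN k
    exact Measurable.ite (measurableSet_lt ih hL) measurable_const (ih.sub hL)

theorem measurable_replenishCount [MeasurableSpace Ω] {N : ℝ≥0 → Ω → ℕ}
    (hm : ∀ t, Measurable (N t)) (hN : ∀ ω, IsDemandPath fun t => N t ω) (k : ℕ) :
    Measurable fun ω => replenishCount q T Q (fun t => N t ω) k :=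
  Finset.measurable_sum _ fun j _ => Measurable.ite
    (measurableSet_lt (measurable_onHand hm hN j) (measurable_cycleLoad hm hN j))
    measurable_const measurable_const

theorem measurable_demandAfter [MeasurableSpace Ω] {N : ℝ≥0 → Ω → ℕ}
    (hm : ∀ t, Measurable (N t)) (hN : ∀ ω, IsDemandPath fun t => N t ω) (k : ℕ) :
    Measurable fun p : Ω × ℝ => demandAfter q T (fun t => N t p.1) k p.2.toNNReal := by
  have h := measurable_uncurry_of_rightCont hm hN
  have hd : Measurable fun p : Ω × ℝ => dispatchTime q T (fun t => N t p.1) k :=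
    (measurable_dispatchTime hm hN k).comp measurable_fst
  exact (h.comp ((hd.add measurable_snd.real_toNNReal).prodMk measurable_fst)).sub
    (h.comp (hd.prodMk measurable_fst))

/-- The `σ`-algebra generated by the demand up to time `t`. -/
@[reducible] def past (N : ℝ≥0 → Ω → ℕ) (t : ℝ≥0) : MeasurableSpace Ω :=
  ⨆ u : Set.Iic t, MeasurableSpace.comap (N u) ⊤

theorem past_mono (N : ℝ≥0 → Ω → ℕ) : Monotone (past N) := fun _ t h =>
  iSup_le fun u => le_iSup (fun u : Set.Iic t => MeasurableSpace.comap (N u) ⊤)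
    ⟨u.1, u.2.trans h⟩

theorem past_le [m : MeasurableSpace Ω] {N : ℝ≥0 → Ω → ℕ} (hm : ∀ t, Measurable (N t))
    (t : ℝ≥0) : past N t ≤ m :=
  iSup_le fun u => (hm u).comap_le

theorem measurable_past (N : ℝ≥0 → Ω → ℕ) {u t : ℝ≥0} (h : u ≤ t) :
    Measurable[past N t] (N u) := by
  refine Measurable.mono (comap_measurable (N u)) ?_ le_rfl
  exact le_iSup (fun u : Set.Iic t => MeasurableSpace.comap (N u) ⊤) ⟨u, h⟩

/-- Events that are determined by the first `k` cycles belong to the past of dispatch `k`. -/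
theorem measurableSet_past_of_dispatchTime_le {N : ℝ≥0 → Ω → ℕ}
    (hN : ∀ ω, IsDemandPath fun t => N t ω) (k : ℕ) {p : ℝ≥0 → ℕ → ℕ → Prop}
    (hp : MeasurableSet {x : ℝ≥0 × ℕ × ℕ | p x.1 x.2.1 x.2.2}) (t : ℝ≥0) :
    MeasurableSet[past N t] ({ω | p (dispatchTime q T (fun t => N t ω) k)
      (onHand q T Q (fun t => N t ω) k) (replenishCount q T Q (fun t => N t ω) k)} ∩
      {ω | dispatchTime q T (fun t => N t ω) k ≤ t}) := by
  let _ := past N t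
  -- The frozen process is measurable for the past of `t`, and on the event that dispatch `k` is at
  -- or before `t` it produces the same dispatch time, stock and count. The event can thus be
  -- rewritten in terms of `N'`.
  set N' : ℝ≥0 → Ω → ℕ := fun s ω => N (min s t) ω with hN'
  have hm' : ∀ s, Measurable (N' s) := fun s => measurable_past N (min_le_right s t)
  have hp' : ∀ ω, IsDemandPath fun s => N' s ω := fun ω => (hN ω).stopped t
  have heq : ∀ ω, ∀ s ≤ t, N s ω = N' s ω := fun ω s hs => by simp [hN', min_eq_left hs]
  have : {ω | p (dispatchTime q T (fun t => N t ω) k)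
      (onHand q T Q (fun t => N t ω) k) (replenishCount q T Q (fun t => N t ω) k)} ∩
      {ω | dispatchTime q T (fun t => N t ω) k ≤ t} =
      {ω | p (dispatchTime q T (fun t => N' t ω) k)
      (onHand q T Q (fun t => N' t ω) k) (replenishCount q T Q (fun t => N' t ω) k)} ∩
      {ω | dispatchTime q T (fun t => N' t ω) k ≤ t} := by
    ext ω
    obtain ⟨h1, h2⟩ := dispatchTime_eq_of_eqOn (q := q) (T := T) (hN ω) (hp' ω) (heq ω) k
    simp only [Set.mem_inter_iff, Set.mem_ofPred_eq, ← h1]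
    refine and_congr_left fun hd => ?_
    obtain ⟨h3, h4⟩ :=
      onHand_replenishCount_eq_of_eqOn (Q := Q) (hN ω) (hp' ω) (heq ω) k hd
    rw [h2 hd, h3, h4]
  rw [this]
  refine MeasurableSet.inter ?_ (measurableSet_le (measurable_dispatchTime hm' hp' k)
    measurable_const)
  exact ((measurable_dispatchTime hm' hp' k).prodMk ((measurable_onHand hm' hp' k).prodMk
    (measurable_replenishCount hm' hp' k))) hp

end Measurability

/-! ### Strong Markov property of the Poisson process -/

section StrongMarkov

variable {Ω : Type*} [MeasurableSpace Ω] {P : Measure Ω} {N : ℝ≥0 → Ω → ℕ} {r : ℝ≥0}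

theorem IsPoissonProcess.isDemandPath (hN : IsPoissonProcess N r P) (ω : Ω) :
    IsDemandPath fun t => N t ω :=
  ⟨hN.mono ω, hN.rightCont ω⟩

variable [IsProbabilityMeasure P]

/-- The past is a directed supremum over finite sets of times. For one finite set, each `N u` is a
sum of successive increments up to `t`, and these are independent of the increment over `[t, t +
h]`. -/
theorem IsPoissonProcess.indep_past (hN : IsPoissonProcess N r P) (t h : ℝ≥0) :
    Indep (past N t) (MeasurableSpace.comap (fun ω => N (t + h) ω - N t ω) ⊤) P := by
  classical
  have hmeas : Measurable fun ω => N (t + h) ω - N t ω := (hN.measurable _).sub (hN.measurable _)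
  have hsup : past N t = ⨆ s : Finset (Set.Iic t), ⨆ u ∈ s, MeasurableSpace.comap (N u) ⊤ :=
    iSup_eq_iSup_finset _
  rw [hsup]
  refine indep_iSup_of_directed_le (fun s => ?_)
    (fun s => iSup₂_le fun u _ => (hN.measurable u).comap_le) hmeas.comap_le
    (Monotone.directed_le fun s s' hs => biSup_mono fun u hu => Finset.mem_of_subset hs hu)
  -- Time `0` is added so that `N u` itself, not just a difference, is a sum of increments.
  set A : Finset ℝ≥0 := insert 0 (s.image Subtype.val) with hA
  have hAt : ∀ a ∈ A, a ≤ t := by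
    intro a ha
    rw [hA, Finset.mem_insert, Finset.mem_image] at ha
    rcases ha with rfl | ⟨b, _, rfl⟩
    · exact zero_le
    · exact b.2
  set p := A.card with hp
  -- The times of `A` in increasing order, then `t` at index `p`, then `t + h` forever. Increment
  -- number `p` is the future one; those with index below `p` generate the observed past.
  set τ : ℕ → ℝ≥0 := fun k => if hk : k < p then A.orderEmbOfFin rfl ⟨k, hk⟩
    else if k = p then t else t + h with hτ
  have hτp : τ p = t := by simp [hτ]
  have hτp1 : τ (p + 1) = t + h := by simp [hτ]
  have hτmono : Monotone τ := by
    refine monotone_nat_of_le_succ fun k => ?_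
    by_cases h1 : k + 1 < p
    · simp only [hτ, h1, dif_pos, show k < p by omega]
      exact (A.orderEmbOfFin rfl).monotone (by simp)
    · by_cases h2 : k < p
      · rw [show k + 1 = p by omega, hτp]
        simp only [hτ, h2, dif_pos]
        exact hAt _ (A.orderEmbOfFin_mem rfl _)
      · simp only [hτ, h1, h2, dif_neg, not_false_eq_true, show k + 1 ≠ p by omega, if_false]
        split_ifs
        · exact le_self_add
        · exact le_rfl
  have hτA : ∀ a ∈ A, ∃ k < p, τ k = a := by
    intro a ha
    have : a ∈ Set.range (A.orderEmbOfFin rfl) := by rw [A.range_orderEmbOfFin]; exact ha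
    obtain ⟨⟨k, hk⟩, rfl⟩ := this
    exact ⟨k, hk, by simp [hτ, hp, hk]⟩
  have hp0 : 0 < p := Finset.card_pos.2 ⟨0, by simp [hA]⟩
  have hτ0 : τ 0 = 0 := by
    obtain ⟨k, _, hk⟩ := hτA 0 (by simp [hA])
    exact le_antisymm (hk ▸ hτmono (Nat.zero_le k)) zero_le
  have hi := hN.indepIncrements.nat hτmono
  have key := indep_iSup_of_disjoint (fun i => Measurable.comap_le
    ((hN.measurable (τ (i + 1))).sub (hN.measurable (τ i)))) hi
    (S := Set.Iio p) (T := {p}) (by simp)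
  refine indep_of_indep_of_le_left (indep_of_indep_of_le_right key ?_) ?_
  · refine le_trans (le_of_eq ?_) (le_iSup₂ p (Set.mem_singleton p))
    simp only [hτp, hτp1]
    rfl
  · refine iSup₂_le fun u hu => ?_
    obtain ⟨k, hk, hku⟩ := hτA u (by
      rw [hA]; exact Finset.mem_insert_of_mem (Finset.mem_image_of_mem _ hu))
    rw [← hku, ← measurable_iff_comap_le]
    have : ∀ k ≤ p, Measurable[⨆ i ∈ Set.Iio p, MeasurableSpace.comap
        (fun ω => N (τ (i + 1)) ω - N (τ i) ω) ⊤] (N (τ k)) := by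
      intro k
      induction k with
      | zero =>
        intro _
        rw [hτ0, show N 0 = fun _ => 0 from funext hN.zero]
        exact measurable_const
      | succ k ih =>
        intro hk
        have e : N (τ (k + 1)) = fun ω => N (τ k) ω + (N (τ (k + 1)) ω - N (τ k) ω) := by
          ext ω
          have := hN.mono ω (hτmono (Nat.le_succ k))
          simp only [Nat.succ_eq_add_one] at this
          omega
        rw [e]
        refine Measurable.add (ih (by omega)) ?_
        refine Measurable.mono (comap_measurable _) ?_ le_rfl
        exact le_iSup₂ (f := fun i (_ : i ∈ Set.Iio p) => MeasurableSpace.comap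
          (fun ω => N (τ (i + 1)) ω - N (τ i) ω) ⊤) k (by simpa using hk)
    exact this k hk.le

theorem IsPoissonProcess.setIntegral_increment (hN : IsPoissonProcess N r P) {A : Set Ω}
    {t : ℝ≥0} (hA : MeasurableSet[past N t] A) (s : ℝ≥0) (f : ℕ → ℝ) :
    ∫ ω in A, f (N (t + s) ω - N t ω) ∂P = P.real A * ∫ y, f y ∂(poissonMeasure (r * s)) := by
  have hmeas : Measurable fun ω => N (t + s) ω - N t ω := (hN.measurable _).sub (hN.measurable _)
  rw [(hN.indep_past t s).setIntegral_eq_mul (past_le hN.measurable t) hmeas.aemeasurable hA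
    .of_discrete]
  congr 1
  exact (hN.law_increment t s).integral_comp .of_discrete

/-- The strong Markov property at the random time `σ`, for the increment over a fixed time. -/
theorem IsPoissonProcess.setIntegral_increment_of_stopping (hN : IsPoissonProcess N r P)
    {σ : Ω → ℝ≥0} (hσ : Measurable σ) {F : Set Ω} (hF : MeasurableSet F)
    (hpast : ∀ t, MeasurableSet[past N t] (F ∩ {ω | σ ω ≤ t})) (s : ℝ≥0) {f : ℕ → ℝ} {B : ℝ}
    (hB : ∀ y, |f y| ≤ B) :
    ∫ ω in F, f (N (σ ω + s) ω - N (σ ω) ω) ∂P =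
      P.real F * ∫ y, f y ∂(poissonMeasure (r * s)) := by
  set a := ∫ y, f y ∂(poissonMeasure (r * s)) with ha
  have hfm : ∀ {g : Ω → ℝ≥0}, Measurable g →
      Measurable fun ω => f (N (g ω + s) ω - N (g ω) ω) := fun {g} hg =>
    (Measurable.of_discrete (f := f)).comp ((measurable_eval hN.measurable hN.isDemandPath
      (hg.add_const s)).sub (measurable_eval hN.measurable hN.isDemandPath hg))
  have hfi : ∀ {g : Ω → ℝ≥0}, Measurable g →
      Integrable (fun ω => f (N (g ω + s) ω - N (g ω) ω)) P := fun {g} hg =>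
    Integrable.of_bound (hfm hg).aestronglyMeasurable B (Eventually.of_forall fun ω => hB _)
  have hgrid : ∀ m, Measurable fun ω => gridAbove m (σ ω) := fun m =>
    Measurable.div_const ((measurable_of_countable _).comp
      (Nat.measurable_ceil.comp (hσ.mul_const _))) _
  -- For the rounded-up time, split `F` by the countably many grid values; on each piece the time is
  -- deterministic and `indep_past` applies.
  have step : ∀ m, ∫ ω in F, (f (N (gridAbove m (σ ω) + s) ω - N (gridAbove m (σ ω)) ω) - a) ∂P
      = 0 := by
    intro m
    set S : ℕ → Set Ω := fun j => F ∩ {ω | ⌈σ ω * (m + 1)⌉₊ = j} with hS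
    have hU : F = ⋃ j, S j := by
      ext ω
      simp [hS]
    have hSm : ∀ j, MeasurableSet (S j) := fun j => hF.inter
      (Nat.measurable_ceil.comp (hσ.mul_const _) (measurableSet_singleton j))
    have hSp : ∀ j : ℕ, MeasurableSet[past N ((j : ℝ≥0) / (m + 1))] (S j) := by
      intro j
      -- Rounding up makes the piece depend only on whether `σ` is at most grid points up to `j / (m
      -- + 1)`, hence on the past of that point.
      have e : S j = (F ∩ {ω | σ ω ≤ (j : ℝ≥0) / (m + 1)}) \
          ⋃ i : Fin j, (F ∩ {ω | σ ω ≤ ((i : ℕ) : ℝ≥0) / (m + 1)}) := by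
        ext ω
        have hc : ∀ i : ℕ, σ ω ≤ (i : ℝ≥0) / (m + 1) ↔ ⌈σ ω * (m + 1)⌉₊ ≤ i := fun i => by
          rw [le_div_iff₀ (by positivity), Nat.ceil_le]
        simp only [hS, Set.mem_inter_iff, Set.mem_ofPred_eq, Set.mem_sdiff, Set.mem_iUnion, hc]
        constructor
        · rintro ⟨h1, h2⟩
          exact ⟨⟨h1, h2.le⟩, by rintro ⟨i, _, hi⟩; have := i.2; omega⟩
        · rintro ⟨⟨h1, h2⟩, h3⟩
          refine ⟨h1, le_antisymm h2 ?_⟩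
          by_contra! hlt
          exact h3 ⟨⟨_, hlt⟩, h1, le_rfl⟩
      rw [e]
      refine MeasurableSet.diff (hpast _) (MeasurableSet.iUnion fun i => ?_)
      refine past_mono N ?_ _ (hpast _)
      have : (i : ℕ) ≤ j := i.2.le
      gcongr
    have hint : Integrable (fun ω =>
        f (N (gridAbove m (σ ω) + s) ω - N (gridAbove m (σ ω)) ω) - a) P :=
      (hfi (hgrid m)).sub (integrable_const a)
    rw [hU, integral_iUnion hSm ?_ hint.integrableOn]
    · rw [tsum_congr, tsum_zero]
      intro j
      have : ∫ ω in S j, (f (N (gridAbove m (σ ω) + s) ω - N (gridAbove m (σ ω)) ω) - a) ∂P =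
          ∫ ω in S j, (f (N ((j : ℝ≥0) / (m + 1) + s) ω - N ((j : ℝ≥0) / (m + 1)) ω) - a) ∂P := by
        refine setIntegral_congr_fun (hSm j) fun ω hω => ?_
        have : gridAbove m (σ ω) = (j : ℝ≥0) / (m + 1) := by
          rw [gridAbove, show ⌈σ ω * (m + 1)⌉₊ = j from hω.2]
        simp only [this]
      rw [this, integral_sub (hfi measurable_const).integrableOn (integrable_const a),
        hN.setIntegral_increment (hSp j)]
      simp [ha]
    · intro i j hij
      rw [Function.onFun, Set.disjoint_left]
      rintro ω ⟨_, h1⟩ ⟨_, h2⟩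
      exact hij (h1.symm.trans h2)
  -- The rounded times decrease to `σ` from the right in the limit sense, and right-continuity in a
  -- discrete space makes the increments eventually equal; `f` needs only to be bounded.
  have hlim : Tendsto (fun m => ∫ ω in F,
      (f (N (gridAbove m (σ ω) + s) ω - N (gridAbove m (σ ω)) ω) - a) ∂P) atTop
      (𝓝 (∫ ω in F, (f (N (σ ω + s) ω - N (σ ω) ω) - a) ∂P)) := by
    refine tendsto_integral_of_dominated_convergence (fun _ => B + |a|)
      (fun m => ((hfm (hgrid m)).sub_const a).aestronglyMeasurable) (integrable_const _)
      (fun m => Eventually.of_forall fun ω => ?_) (Eventually.of_forall fun ω => ?_)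
    · exact (abs_sub _ _).trans (add_le_add (hB _) le_rfl)
    · have h1 := tendsto_gridAbove (σ ω)
      have h2 : Tendsto (fun m => gridAbove m (σ ω) + s) atTop (𝓝[≥] (σ ω + s)) :=
        tendsto_nhdsWithin_iff.2 ⟨(tendsto_nhds_of_tendsto_nhdsWithin h1).add_const s,
          Eventually.of_forall fun m => by
            simpa using le_gridAbove m (σ ω)⟩
      have e1 := ((hN.rightCont ω (σ ω)).tendsto.comp h1)
      have e2 := ((hN.rightCont ω (σ ω + s)).tendsto.comp h2)
      rw [nhds_discrete, tendsto_pure] at e1 e2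
      refine tendsto_const_nhds.congr' ?_
      filter_upwards [e1, e2] with m h1 h2
      simp only [Function.comp_apply] at h1 h2
      rw [h1, h2]
  have hzero := tendsto_nhds_unique hlim (by simp only [step]; exact tendsto_const_nhds)
  rw [integral_sub (hfi hσ).integrableOn (integrable_const a)] at hzero
  simp only [integral_const, smul_eq_mul, measureReal_restrict_apply_univ] at hzero
  linarith

end StrongMarkov

/-! ### Almost surely, orders arrive one at a time -/

section UnitJumps

variable {Ω : Type*} [MeasurableSpace Ω] {P : Measure Ω} [IsProbabilityMeasure P]
  {N : ℝ≥0 → Ω → ℕ} {r : ℝ≥0}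

/-- The probability is `1 - e^{-μ} (1 + μ)`, and `e^{-μ} ≥ 1 - μ`. -/
theorem poissonMeasure_real_two_le (μ : ℝ≥0) :
    (poissonMeasure μ).real {y | 2 ≤ y} ≤ (μ : ℝ) ^ 2 := by
  have h1 : {y : ℕ | 2 ≤ y} = ({0, 1} : Set ℕ)ᶜ := by
    ext y; simp; omega
  have h2 : (poissonMeasure μ).real {0, 1} = Real.exp (-μ) * (1 + μ) := by
    rw [Set.insert_eq, measureReal_union (by simp) (measurableSet_singleton _),
      poissonMeasure_real_singleton, poissonMeasure_real_singleton]
    simp; ring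
  rw [h1, probReal_compl_eq_one_sub (Set.Finite.measurableSet (by simp)), h2]
  have h3 := Real.add_one_le_exp (-(μ : ℝ))
  have h4 : (0 : ℝ) ≤ μ := μ.coe_nonneg
  nlinarith

/-- On `[0, K]` with mesh `1 / m` there are `K m` cells, each with two or more arrivals with
probability at most `(r / m) ^ 2`. The union bound `K r ^ 2 / m` tends to `0`, so almost surely some
mesh has no bad cell. -/
theorem IsPoissonProcess.ae_hasUnitJumps (hN : IsPoissonProcess N r P) :
    ∀ᵐ ω ∂P, HasUnitJumps fun t => N t ω := by
  refine ae_all_iff.2 fun K => ?_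
  rw [ae_iff, ← measureReal_eq_zero_iff]
  set E := {ω | ¬ ∃ m : ℕ, 0 < m ∧
    ∀ j < K * m, N (((j + 1 : ℕ) : ℝ≥0) / m) ω ≤ N ((j : ℝ≥0) / m) ω + 1} with hE
  have hbound : ∀ m : ℕ, P.real E ≤ K * (r : ℝ) ^ 2 * (1 / ((m : ℝ) + 1)) := by
    intro m
    have hsub : E ⊆ ⋃ j ∈ Finset.range (K * (m + 1)),
        {ω | 2 ≤ N ((j : ℝ≥0) / (m + 1 : ℕ) + 1 / (m + 1 : ℕ)) ω -
          N ((j : ℝ≥0) / (m + 1 : ℕ)) ω} := by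
      intro ω hω
      rw [hE, Set.mem_ofPred_eq] at hω
      push Not at hω
      obtain ⟨j, hj, hj2⟩ := hω (m + 1) (by omega)
      refine Set.mem_biUnion (Finset.mem_range.2 hj) ?_
      rw [Set.mem_ofPred_eq, ← add_div]
      rw [Nat.cast_succ (R := ℝ≥0) j] at hj2
      omega
    refine (measureReal_mono hsub (measure_ne_top _ _)).trans ((measureReal_biUnion_finset_le _ _).trans ?_)
    have hj : ∀ j ∈ Finset.range (K * (m + 1)),
        P.real {ω | 2 ≤ N ((j : ℝ≥0) / (m + 1 : ℕ) + 1 / (m + 1 : ℕ)) ω -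
          N ((j : ℝ≥0) / (m + 1 : ℕ)) ω} ≤ ((r : ℝ) * (1 / (m + 1))) ^ 2 := by
      intro j _
      rw [(hN.law_increment _ _).measureReal_eq (p := fun y => 2 ≤ y) .of_discrete]
      refine (poissonMeasure_real_two_le _).trans (le_of_eq ?_)
      push_cast; rfl
    refine (Finset.sum_le_sum hj).trans (le_of_eq ?_)
    rw [Finset.sum_const, Finset.card_range, nsmul_eq_mul]
    push_cast
    have : (m : ℝ) + 1 ≠ 0 := by positivity
    field_simp
  have hlim : Tendsto (fun m : ℕ => K * (r : ℝ) ^ 2 * (1 / ((m : ℝ) + 1))) atTop (𝓝 0) := by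
    simpa using tendsto_one_div_add_atTop_nhds_zero_nat.const_mul (K * (r : ℝ) ^ 2)
  exact le_antisymm (ge_of_tendsto' hlim hbound) measureReal_nonneg

end UnitJumps

/-! ### Differentiating Poisson expectations in the mean -/

section PoissonCalculus

/-- The Poisson weight `e^{-x} x^j / j!`. -/
noncomputable def poissonWeight (j : ℕ) (x : ℝ) : ℝ := Real.exp (-x) * x ^ j / (j.factorial : ℝ)

theorem integral_poisson_of_support {μ : ℝ≥0} {q : ℕ} {G : ℕ → ℝ} (hG : ∀ y, q ≤ y → G y = 0) :
    ∫ y, G y ∂(poissonMeasure μ) = ∑ j ∈ Finset.range q, G j * poissonWeight j μ := by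
  rw [integral_poissonMeasure, tsum_eq_sum (s := Finset.range q)]
  · exact Finset.sum_congr rfl fun j _ => by rw [smul_eq_mul, mul_comm]; rfl
  · intro j hj
    rw [hG j (by simpa using hj), smul_zero]

/-- Constancy beyond `q` turns the expectation into a finite sum, which can be differentiated
without interchanging limits. -/
theorem integral_poisson_of_const {μ : ℝ≥0} {q : ℕ} {F : ℕ → ℝ} (hF : ∀ y, q ≤ y → F y = F q) :
    ∫ y, F y ∂(poissonMeasure μ) =
      F q + ∑ j ∈ Finset.range q, (F j - F q) * poissonWeight j μ := by
  have h1 : HasSum (fun j => (F j - F q) * poissonWeight j μ)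
      (∑ j ∈ Finset.range q, (F j - F q) * poissonWeight j μ) :=
    hasSum_sum_of_ne_finset_zero fun j hj => by
      rw [hF j (by simpa using hj), sub_self, zero_mul]
  have h2 := (hasSum_one_poissonMeasure μ).mul_left (F q)
  have h3 := h2.add h1
  rw [mul_one] at h3
  rw [integral_poissonMeasure, ← h3.tsum_eq]
  congr 1
  ext j
  rw [smul_eq_mul, poissonWeight]
  ring

theorem hasDerivAt_poissonWeight_zero (x : ℝ) :
    HasDerivAt (poissonWeight 0) (-poissonWeight 0 x) x := by
  have : poissonWeight 0 = fun x => Real.exp (-x) := by ext; simp [poissonWeight]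
  rw [this]
  simpa using (hasDerivAt_neg x).exp

theorem hasDerivAt_poissonWeight_succ (j : ℕ) (x : ℝ) :
    HasDerivAt (poissonWeight (j + 1)) (poissonWeight j x - poissonWeight (j + 1) x) x := by
  have h := (((hasDerivAt_neg x).exp).mul (hasDerivAt_pow (j + 1) x)).div_const
    ((j + 1).factorial : ℝ)
  refine h.congr_deriv ?_
  simp only [poissonWeight, Nat.factorial_succ, Nat.add_sub_cancel]
  push_cast
  have : (j.factorial : ℝ) ≠ 0 := by positivity
  field_simp
  ring

/-- Kolmogorov's equation `d/dx E[F(Y_x)] = E[F(Y_x + 1) - F(Y_x)]`: the weights satisfy `w_{j+1}' =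
w_j - w_{j+1}`, and a summation by parts moves the difference onto `F`. -/
theorem hasDerivAt_poisson_sum (q : ℕ) (F : ℕ → ℝ) (x : ℝ) :
    HasDerivAt (fun x => F q + ∑ j ∈ Finset.range q, (F j - F q) * poissonWeight j x)
      (∑ j ∈ Finset.range q, (F (j + 1) - F j) * poissonWeight j x) x := by
  cases q with
  | zero => simpa using hasDerivAt_const x (F 0)
  | succ q =>
    have h0 := (hasDerivAt_poissonWeight_zero x).const_mul (F 0 - F (q + 1))
    have hs := HasDerivAt.fun_sum (u := Finset.range q) fun j _ =>
      (hasDerivAt_poissonWeight_succ j x).const_mul (F (j + 1) - F (q + 1))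
    simp only [Finset.sum_range_succ' (fun j => (F j - F (q + 1)) * poissonWeight j _)]
    refine ((hs.add h0).const_add (F (q + 1))).congr_deriv ?_
    have e1 : ∑ j ∈ Finset.range (q + 1), (F (j + 1) - F j) * poissonWeight j x =
        ∑ j ∈ Finset.range (q + 1), (F (j + 1) - F (q + 1)) * poissonWeight j x -
        ∑ j ∈ Finset.range (q + 1), (F j - F (q + 1)) * poissonWeight j x := by
      rw [← Finset.sum_sub_distrib]
      exact Finset.sum_congr rfl fun j _ => by ring
    rw [e1, Finset.sum_range_succ (fun j => (F (j + 1) - F (q + 1)) * poissonWeight j x),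
      Finset.sum_range_succ' (fun j => (F j - F (q + 1)) * poissonWeight j x)]
    simp only [mul_sub, Finset.sum_sub_distrib]
    ring

theorem continuous_poissonWeight (j : ℕ) : Continuous (poissonWeight j) := by
  unfold poissonWeight
  fun_prop

/-- The expected time integral of `F (Y + 1) - F Y` along a Poisson process, for a function `F`
that is constant on `[q, ∞)`. -/
theorem integral_integral_poisson {r : ℝ≥0} (hr : 0 < r) (T : ℝ≥0) {q : ℕ} {F : ℕ → ℝ}
    (hF : ∀ y, q ≤ y → F y = F q) :
    ∫ s in (0 : ℝ)..T, ∫ y, (if y < q then F (y + 1) - F y else 0)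
      ∂(poissonMeasure (r * s.toNNReal)) =
      (∫ y, F y ∂(poissonMeasure (r * T)) - F 0) / r := by
  have hr' : (r : ℝ) ≠ 0 := by exact_mod_cast hr.ne'
  have h1 : ∀ s ∈ Set.uIcc (0 : ℝ) T, ∫ y, (if y < q then F (y + 1) - F y else 0)
      ∂(poissonMeasure (r * s.toNNReal)) =
      ∑ j ∈ Finset.range q, (F (j + 1) - F j) * poissonWeight j (r * s) := by
    intro s hs
    rw [Set.uIcc_of_le T.coe_nonneg] at hs
    rw [integral_poisson_of_support (q := q) fun y hy => if_neg (not_lt.2 hy)]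
    refine Finset.sum_congr rfl fun j hj => ?_
    rw [if_pos (Finset.mem_range.1 hj), NNReal.coe_mul, Real.coe_toNNReal _ hs.1]
  rw [intervalIntegral.integral_congr h1, integral_poisson_of_const hF]
  -- Thus `E[F(Y_{rs})] / r` is an antiderivative of the integrand, and at `s = 0` only the weight
  -- of `0` survives.
  have hd : ∀ s : ℝ, HasDerivAt (fun s : ℝ => (F q +
      ∑ j ∈ Finset.range q, (F j - F q) * poissonWeight j (r * s)) / r)
      (∑ j ∈ Finset.range q, (F (j + 1) - F j) * poissonWeight j (r * s)) s := by
    intro s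
    have := ((hasDerivAt_poisson_sum q F (r * s)).comp s
      ((hasDerivAt_id s).const_mul (r : ℝ))).div_const (r : ℝ)
    refine this.congr_deriv ?_
    field_simp
  have hc : Continuous fun s : ℝ =>
      ∑ j ∈ Finset.range q, (F (j + 1) - F j) * poissonWeight j (r * s) :=
    continuous_finsetSum _ fun j _ => continuous_const.mul
      ((continuous_poissonWeight j).comp (continuous_const.mul continuous_id))
  rw [intervalIntegral.integral_eq_sub_of_hasDerivAt (fun s _ => hd s)
    (hc.intervalIntegrable _ _)]
  have h0 : F q + ∑ j ∈ Finset.range q, (F j - F q) * poissonWeight j (r * (0 : ℝ)) = F 0 := by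
    cases q with
    | zero => simp
    | succ q => simp [Finset.sum_range_succ', poissonWeight]
  rw [h0, NNReal.coe_mul]
  ring

end PoissonCalculus

/-! ### Renewal equations for the truncated Poisson law -/

section Renewal

variable {μ : ℝ≥0} {q : ℕ}

theorem truncPMF_nonneg (i : ℕ) : 0 ≤ truncPMF μ q i := measureReal_nonneg

theorem truncPMF_zero (hq : 0 < q) : truncPMF μ q 0 = Real.exp (-μ) := by
  have : {y : ℕ | min y q = 0} = {0} := by ext y; simp; omega
  rw [truncPMF, this, poissonMeasure_real_singleton]
  simp

theorem convPMF_nonneg (k i : ℕ) : 0 ≤ convPMF μ q k i := by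
  induction k generalizing i with
  | zero => rw [convPMF]; split_ifs <;> norm_num
  | succ k ih =>
    exact Finset.sum_nonneg fun j _ => mul_nonneg (ih j) (truncPMF_nonneg _)

/-- Strong induction on `i`. In the convolution recursion only the term `j = i` involves `i` again,
with factor `g(0) = e^{-μ} < 1`, so the partial sums `S` obey `S ≤ K + g(0) S`. -/
theorem summable_convPMF (hμ : 0 < μ) (hq : 0 < q) (i : ℕ) :
    Summable fun k => convPMF μ q k i := by
  induction i using Nat.strong_induction_on with
  | _ i ih =>
    set g0 := truncPMF μ q 0
    have hg0 : g0 < 1 := by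
      simp only [g0]
      rw [truncPMF_zero hq, Real.exp_lt_one_iff]
      simpa using hμ
    -- The `1` bounds the term `k = 0`; the sum bounds the contributions of `j < i`, finite by
    -- induction.
    set K := 1 + ∑ j ∈ Finset.range i, (∑' k, convPMF μ q k j) * truncPMF μ q (i - j)
    refine summable_of_sum_range_le (c := K / (1 - g0)) (fun k => convPMF_nonneg k i) fun n => ?_
    rw [le_div_iff₀ (by linarith)]
    have h1 : ∑ k ∈ Finset.range n, convPMF μ q k i ≤
        ∑ k ∈ Finset.range (n + 1), convPMF μ q k i := by
      rw [Finset.sum_range_succ]; linarith [convPMF_nonneg (μ := μ) (q := q) n i]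
    have h2 : ∑ k ∈ Finset.range (n + 1), convPMF μ q k i ≤
        K + (∑ k ∈ Finset.range n, convPMF μ q k i) * g0 := by
      rw [Finset.sum_range_succ']
      simp only [convPMF, Finset.sum_range_succ _ i, Nat.sub_self, Finset.sum_add_distrib,
        ← Finset.sum_mul]
      rw [Finset.sum_comm]
      have h3 : (if i = 0 then (1 : ℝ) else 0) ≤ 1 := by split_ifs <;> norm_num
      have h4 : ∑ j ∈ Finset.range i, ∑ k ∈ Finset.range n,
          convPMF μ q k j * truncPMF μ q (i - j) ≤
          ∑ j ∈ Finset.range i, (∑' k, convPMF μ q k j) * truncPMF μ q (i - j) := by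
        refine Finset.sum_le_sum fun j hj => ?_
        rw [← Finset.sum_mul]
        exact mul_le_mul_of_nonneg_right ((ih j (Finset.mem_range.1 hj)).sum_le_tsum _
          fun k _ => convPMF_nonneg k j) (truncPMF_nonneg _)
      linarith
    linarith

theorem summable_convCDF (hμ : 0 < μ) (hq : 0 < q) (i : ℕ) :
    Summable fun k => convCDF μ q k i :=
  summable_sum fun j _ => summable_convPMF hμ hq j

theorem renewalMass_nonneg (i : ℕ) : 0 ≤ renewalMass μ q i :=
  tsum_nonneg fun k => convPMF_nonneg k i

theorem renewalMass_eq (hμ : 0 < μ) (hq : 0 < q) (i : ℕ) :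
    renewalMass μ q i = (if i = 0 then 1 else 0) +
      ∑ j ∈ Finset.range (i + 1), renewalMass μ q j * truncPMF μ q (i - j) := by
  rw [renewalMass, (summable_convPMF hμ hq i).tsum_eq_zero_add]
  simp only [convPMF]
  rw [Summable.tsum_finsetSum fun j _ => (summable_convPMF hμ hq j).mul_right _]
  simp only [tsum_mul_right, renewalMass]

theorem renewalFun_eq_sum (hμ : 0 < μ) (hq : 0 < q) (i : ℕ) :
    renewalFun μ q i = ∑ j ∈ Finset.range (i + 1), renewalMass μ q j := by
  simp only [renewalFun, convCDF]
  exact Summable.tsum_finsetSum fun j _ => summable_convPMF hμ hq j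

/-- Condition on the next load: `M_G(i)` is the expected number of dispatches in a replenishment
cycle started with `i` units. The induction on `i` adds up the renewal equation of the mass
function. -/
theorem renewalFun_eq (hμ : 0 < μ) (hq : 0 < q) (i : ℕ) :
    renewalFun μ q i = 1 +
      ∑ y ∈ Finset.range (i + 1), truncPMF μ q y * renewalFun μ q (i - y) := by
  induction i with
  | zero =>
    have := renewalMass_eq hμ hq 0
    simp only [renewalFun_eq_sum hμ hq, zero_add, Finset.sum_range_one, if_pos,
      Nat.sub_self] at this ⊢
    linarith
  | succ i ih =>
    have h1 : ∀ j, renewalFun μ q (j + 1) = renewalFun μ q j + renewalMass μ q (j + 1) :=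
      fun j => by
        rw [renewalFun_eq_sum hμ hq, renewalFun_eq_sum hμ hq, Finset.sum_range_succ _ (j + 1)]
    have h0 : renewalFun μ q 0 = renewalMass μ q 0 := by simp [renewalFun_eq_sum hμ hq]
    have h2 : ∑ y ∈ Finset.range (i + 1), truncPMF μ q y * renewalFun μ q (i + 1 - y) =
        ∑ y ∈ Finset.range (i + 1), truncPMF μ q y * renewalFun μ q (i - y) +
        ∑ y ∈ Finset.range (i + 1), truncPMF μ q y * renewalMass μ q (i + 1 - y) := by
      rw [← Finset.sum_add_distrib]
      refine Finset.sum_congr rfl fun y hy => ?_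
      have := Finset.mem_range.1 hy
      rw [show i + 1 - y = (i - y) + 1 by omega, h1, mul_add]
    rw [Finset.sum_range_succ _ (i + 1), h2, Nat.sub_self, h0, h1, ih,
      renewalMass_eq hμ hq (i + 1), if_neg (Nat.succ_ne_zero i),
      ← Finset.sum_range_reflect _ (i + 1 + 1), Finset.sum_range_succ _ (i + 1)]
    -- Commutativity of the convolution, after reversing the order of summation.
    have h3 : ∑ j ∈ Finset.range (i + 1), renewalMass μ q (i + 1 + 1 - 1 - j) *
        truncPMF μ q (i + 1 - (i + 1 + 1 - 1 - j)) =
        ∑ y ∈ Finset.range (i + 1), truncPMF μ q y * renewalMass μ q (i + 1 - y) := by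
      refine Finset.sum_congr rfl fun j hj => ?_
      have := Finset.mem_range.1 hj
      rw [mul_comm, show i + 1 - (i + 1 + 1 - 1 - j) = j by omega,
        show i + 1 + 1 - 1 - j = i + 1 - j by omega]
    rw [h3, show i + 1 + 1 - 1 - (i + 1) = 0 by omega, Nat.sub_zero]
    ring

/-- The sum `∑_{j < i} M_G(j)`, the expected sum of the stock levels at the dispatches of a
replenishment cycle that starts with `i` units. -/
noncomputable def renewalSum (μ : ℝ≥0) (q i : ℕ) : ℝ := ∑ j ∈ Finset.range i, renewalFun μ q j

theorem renewalSum_eq_sum (hμ : 0 < μ) (hq : 0 < q) (i : ℕ) :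
    renewalSum μ q i =
      ∑ j ∈ Finset.range (i + 1), ((i : ℝ) - (j : ℝ)) * renewalMass μ q j := by
  induction i with
  | zero => simp [renewalSum]
  | succ i ih =>
    rw [renewalSum, Finset.sum_range_succ, ← renewalSum, ih, renewalFun_eq_sum hμ hq,
      Finset.sum_range_succ _ (i + 1), sub_self, zero_mul, add_zero, ← Finset.sum_add_distrib]
    refine Finset.sum_congr rfl fun j _ => ?_
    push_cast
    ring

/-- The same renewal equation with a charge `i` in place of `1`; its increment in `i` is the
equation of `renewalFun`. -/
theorem renewalSum_eq (hμ : 0 < μ) (hq : 0 < q) (i : ℕ) :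
    renewalSum μ q i = i +
      ∑ y ∈ Finset.range (i + 1), truncPMF μ q y * renewalSum μ q (i - y) := by
  induction i with
  | zero => simp [renewalSum]
  | succ i ih =>
    have h1 : ∀ j, renewalSum μ q (j + 1) = renewalSum μ q j + renewalFun μ q j :=
      fun j => Finset.sum_range_succ _ _
    have h2 : ∑ y ∈ Finset.range (i + 1), truncPMF μ q y * renewalSum μ q (i + 1 - y) =
        ∑ y ∈ Finset.range (i + 1), truncPMF μ q y * renewalSum μ q (i - y) +
        ∑ y ∈ Finset.range (i + 1), truncPMF μ q y * renewalFun μ q (i - y) := by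
      rw [← Finset.sum_add_distrib]
      refine Finset.sum_congr rfl fun y hy => ?_
      have := Finset.mem_range.1 hy
      rw [show i + 1 - y = (i - y) + 1 by omega, h1, mul_add]
    have h0 : renewalSum μ q 0 = 0 := by simp [renewalSum]
    have h3 := renewalFun_eq hμ hq i
    rw [Finset.sum_range_succ _ (i + 1), h2, Nat.sub_self, h0, h1, ih]
    push_cast
    linarith

theorem one_le_renewalFun (hμ : 0 < μ) (hq : 0 < q) (i : ℕ) : 1 ≤ renewalFun μ q i := by
  have h0 : (1 : ℝ) ≤ renewalMass μ q 0 := by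
    rw [renewalMass_eq hμ hq 0]
    simp only [if_pos, zero_add, Finset.sum_range_one]
    linarith [mul_nonneg (renewalMass_nonneg (μ := μ) (q := q) 0)
      (truncPMF_nonneg (μ := μ) (q := q) (0 - 0))]
  rw [renewalFun_eq_sum hμ hq]
  exact h0.trans (Finset.single_le_sum (f := fun j => renewalMass μ q j)
    (fun j _ => renewalMass_nonneg j) (by simp))

end Renewal

/-! ### Means of load, length and waiting time given the past of a dispatch -/

section DispatchEvent

variable {Ω : Type*} [MeasurableSpace Ω] {P : Measure Ω} {N : ℝ≥0 → Ω → ℕ} {r : ℝ≥0}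
  {q : ℕ} {T : ℝ≥0} {Q : ℕ} {k : ℕ} {F : Set Ω}

/-- `F` is determined by the demand up to dispatch `k`. -/
def IsDispatchEvent (N : ℝ≥0 → Ω → ℕ) (q : ℕ) (T : ℝ≥0) (k : ℕ) (F : Set Ω) : Prop :=
  MeasurableSet F ∧ ∀ t, MeasurableSet[past N t]
    (F ∩ {ω | dispatchTime q T (fun t => N t ω) k ≤ t})

theorem IsDispatchEvent.inter {G : Set Ω} (hF : IsDispatchEvent N q T k F)
    (hG : IsDispatchEvent N q T k G) : IsDispatchEvent N q T k (F ∩ G) := by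
  refine ⟨hF.1.inter hG.1, fun t => ?_⟩
  rw [Set.inter_inter_distrib_right]
  exact MeasurableSet.inter (hF.2 t) (hG.2 t)

theorem IsPoissonProcess.isDispatchEvent (hN : IsPoissonProcess N r P) (k : ℕ)
    {p : ℝ≥0 → ℕ → ℕ → Prop} (hp : MeasurableSet {x : ℝ≥0 × ℕ × ℕ | p x.1 x.2.1 x.2.2}) :
    IsDispatchEvent N q T k {ω | p (dispatchTime q T (fun t => N t ω) k)
      (onHand q T Q (fun t => N t ω) k) (replenishCount q T Q (fun t => N t ω) k)} :=
  ⟨((measurable_dispatchTime hN.measurable hN.isDemandPath k).prodMk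
    ((measurable_onHand hN.measurable hN.isDemandPath k).prodMk
    (measurable_replenishCount hN.measurable hN.isDemandPath k))) hp,
    measurableSet_past_of_dispatchTime_le hN.isDemandPath k hp⟩

theorem IsPoissonProcess.measurable_cycleLength (hN : IsPoissonProcess N r P) (k : ℕ) :
    Measurable fun ω => cycleLength q T (fun t => N t ω) k :=
  (measurable_dispatchTime hN.measurable hN.isDemandPath (k + 1)).coe_nnreal_real.sub
    (measurable_dispatchTime hN.measurable hN.isDemandPath k).coe_nnreal_real

theorem IsPoissonProcess.measurable_cycleWaiting (hN : IsPoissonProcess N r P) (k : ℕ) :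
    Measurable fun ω => cycleWaiting q T (fun t => N t ω) k := by
  simp only [cycleWaiting, intervalIntegral.integral_of_le T.coe_nonneg]
  refine StronglyMeasurable.measurable (StronglyMeasurable.integral_prod_right ?_)
  refine Measurable.stronglyMeasurable ?_
  exact (Measurable.of_discrete (f := fun y : ℕ => if y < q then (y : ℝ) else 0)).comp
    (measurable_demandAfter (q := q) (T := T) hN.measurable hN.isDemandPath k)

theorem IsPoissonProcess.measurable_dispatchCost (hN : IsPoissonProcess N r P) (c : CostParams)
    (k : ℕ) : Measurable fun ω => dispatchCost c q T Q (fun t => N t ω) k := by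
  have hL : Measurable fun ω => cycleLoad q T (fun t => N t ω) k :=
    measurable_cycleLoad hN.measurable hN.isDemandPath k
  have hI : Measurable fun ω => onHand q T Q (fun t => N t ω) k :=
    measurable_onHand hN.measurable hN.isDemandPath k
  exact (Measurable.of_discrete (f := fun p : ℕ × ℕ => c.AD + c.cD * (p.1 : ℝ) +
    if p.2 < p.1 then c.AR + c.cR * ((Q : ℝ) + (p.1 : ℝ) - (p.2 : ℝ)) else 0)).comp
    (hL.prodMk hI)

theorem IsPoissonProcess.measurable_cycleCost (hN : IsPoissonProcess N r P) (c : CostParams)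
    (k : ℕ) : Measurable fun ω => cycleCost c q T Q (fun t => N t ω) k := by
  have hI : Measurable fun ω => (onHand q T Q (fun t => N t ω) k : ℝ) :=
    (Measurable.of_discrete (f := fun n : ℕ => (n : ℝ))).comp
      (measurable_onHand hN.measurable hN.isDemandPath k)
  exact ((hN.measurable_dispatchCost c k).add
    ((hI.mul (hN.measurable_cycleLength k)).const_mul c.h)).add
    ((hN.measurable_cycleWaiting k).const_mul c.w)

theorem IsPoissonProcess.measurable_comp_onHand (hN : IsPoissonProcess N r P) (v : ℕ → ℝ)
    (k : ℕ) : Measurable fun ω => v (onHand q T Q (fun t => N t ω) k) :=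
  (Measurable.of_discrete (f := v)).comp (measurable_onHand hN.measurable hN.isDemandPath k)

variable [IsProbabilityMeasure P]

theorem IsPoissonProcess.setIntegral_demandAfter (hN : IsPoissonProcess N r P)
    (hF : IsDispatchEvent N q T k F) (s : ℝ≥0) {f : ℕ → ℝ} {B : ℝ} (hB : ∀ y, |f y| ≤ B) :
    ∫ ω in F, f (demandAfter q T (fun t => N t ω) k s) ∂P =
      P.real F * ∫ y, f y ∂(poissonMeasure (r * s)) :=
  hN.setIntegral_increment_of_stopping
    (measurable_dispatchTime hN.measurable hN.isDemandPath k) hF.1 hF.2 s hB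

theorem abs_comp_min_le (f : ℕ → ℝ) (q y : ℕ) :
    |f (min y q)| ≤ ∑ j ∈ Finset.range (q + 1), |f j| :=
  Finset.single_le_sum (f := fun j => |f j|) (fun _ _ => abs_nonneg _)
    (Finset.mem_range.2 (by omega))

theorem IsPoissonProcess.setIntegral_cycleLoad (hN : IsPoissonProcess N r P) (hq : 0 < q)
    (hT : 0 < T) (hF : IsDispatchEvent N q T k F) (f : ℕ → ℝ) :
    ∫ ω in F, f (cycleLoad q T (fun t => N t ω) k) ∂P =
      P.real F * ∫ y, f (min y q) ∂(poissonMeasure (r * T)) := by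
  rw [← hN.setIntegral_demandAfter hF T (abs_comp_min_le f q)]
  refine setIntegral_congr_ae hF.1 ?_
  filter_upwards [hN.ae_hasUnitJumps] with ω hω _
  rw [cycleLoad_eq_min (hN.isDemandPath ω) hω hq hT]

theorem IsPoissonProcess.setIntegral_integral_demandAfter (hN : IsPoissonProcess N r P)
    (hF : IsDispatchEvent N q T k F) {f : ℕ → ℝ} {B : ℝ} (hB : ∀ y, |f y| ≤ B) :
    ∫ ω in F, (∫ s in (0 : ℝ)..T, f (demandAfter q T (fun t => N t ω) k s.toNNReal)) ∂P =
      P.real F * ∫ s in (0 : ℝ)..T, ∫ y, f y ∂(poissonMeasure (r * s.toNNReal)) := by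
  rw [← intervalIntegral_integral_swap, ← intervalIntegral.integral_const_mul]
  · exact intervalIntegral.integral_congr fun s _ => hN.setIntegral_demandAfter hF _ hB
  · rw [Set.uIoc_of_le T.coe_nonneg]
    refine Integrable.of_bound (Measurable.aestronglyMeasurable ?_) B
      (Eventually.of_forall fun p => hB _)
    exact (Measurable.of_discrete (f := f)).comp ((measurable_demandAfter (q := q) (T := T)
      hN.measurable hN.isDemandPath k).comp measurable_swap)

/-- The length integrates the indicator of `y < q`, which is the forward difference of `F y = min y
q`. -/
theorem IsPoissonProcess.setIntegral_cycleLength (hN : IsPoissonProcess N r P) (hr : 0 < r)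
    (hF : IsDispatchEvent N q T k F) :
    ∫ ω in F, cycleLength q T (fun t => N t ω) k ∂P =
      P.real F * (truncMean (r * T) q / r) := by
  have h1 : ∀ ω, cycleLength q T (fun t => N t ω) k = ∫ s in (0 : ℝ)..T,
      if demandAfter q T (fun t => N t ω) k s.toNNReal < q then (1 : ℝ) else 0 := fun ω => by
    rw [integral_demandAfter_lt (hN.isDemandPath ω) k fun _ => 1]
    simp
  have h3 := hN.setIntegral_integral_demandAfter hF
    (f := fun y => if y < q then (1 : ℝ) else 0) (B := 1) fun y => by split_ifs <;> simp
  simp only [h1]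
  rw [h3]
  congr 1
  have h2 := integral_integral_poisson hr T (q := q) (F := fun y => ((min y q : ℕ) : ℝ))
    fun y hy => by simp [min_eq_right hy]
  simp only [Nat.zero_min, Nat.cast_zero, sub_zero] at h2
  rw [truncMean, ← h2]
  congr 1
  ext s
  congr 1
  ext y
  split_ifs with h
  · rw [min_eq_left (by omega : y + 1 ≤ q), min_eq_left h.le]
    push_cast; ring
  · rfl

/-- The integrand `y` on `y < q` is the forward difference of `F y = min y q * (min y q - 1) / 2`.
-/
theorem IsPoissonProcess.setIntegral_cycleWaiting (hN : IsPoissonProcess N r P) (hr : 0 < r)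
    (hF : IsDispatchEvent N q T k F) :
    ∫ ω in F, cycleWaiting q T (fun t => N t ω) k ∂P =
      P.real F * (truncFactorialMoment (r * T) q / (2 * r)) := by
  have h3 := hN.setIntegral_integral_demandAfter hF
    (f := fun y => if y < q then (y : ℝ) else 0) (B := q) fun y => by
      split_ifs with h
      · rw [Nat.abs_cast]; exact_mod_cast h.le
      · simp
  simp only [cycleWaiting]
  rw [h3]
  congr 1
  have h2 := integral_integral_poisson hr T (q := q)
    (F := fun y => ((min y q : ℕ) : ℝ) * (((min y q : ℕ) : ℝ) - 1) / 2)
    fun y hy => by simp [min_eq_right hy]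
  simp only [Nat.zero_min, Nat.cast_zero, zero_mul, zero_div, sub_zero] at h2
  rw [integral_div] at h2
  rw [truncFactorialMoment, ← div_div, ← h2]
  congr 1
  ext s
  congr 1
  ext y
  split_ifs with h
  · rw [min_eq_left (by omega : y + 1 ≤ q), min_eq_left h.le]
    push_cast; ring
  · rfl

end DispatchEvent

/-! ### The Poisson equation of the inventory chain -/

section OneStep

variable {μ : ℝ≥0} {q Q : ℕ}

/-- The stock after the dispatch of a load `L` when `i` units were on hand. -/
def nextStock (Q i L : ℕ) : ℕ := if i < L then Q else i - L

/-- The probability that `i` units do not suffice for the next dispatch. -/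
noncomputable def shortageProb (μ : ℝ≥0) (q i : ℕ) : ℝ :=
  ∫ y, (if i < min y q then 1 else 0) ∂(poissonMeasure μ)

theorem integrable_comp_min (f : ℕ → ℝ) :
    Integrable (fun y => f (min y q)) (poissonMeasure μ) :=
  Integrable.of_bound .of_discrete _ (Eventually.of_forall fun y => abs_comp_min_le f q y)

theorem integral_indicator_min (j : ℕ) :
    ∫ y, (if min y q = j then (1 : ℝ) else 0) ∂(poissonMeasure μ) = truncPMF μ q j := by
  have : (fun y => if min y q = j then (1 : ℝ) else 0) =
      Set.indicator {y | min y q = j} 1 := by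
    ext y; simp [Set.indicator]
  rw [this, integral_indicator_one .of_discrete, truncPMF]

theorem integral_nextStock (u : ℕ → ℝ) (i : ℕ) :
    ∫ y, u (nextStock Q i (min y q)) ∂(poissonMeasure μ) = shortageProb μ q i * u Q +
      ∑ j ∈ Finset.range (i + 1), truncPMF μ q j * u (i - j) := by
  have h : ∀ y, u (nextStock Q i (min y q)) = (if i < min y q then 1 else 0) * u Q +
      ∑ j ∈ Finset.range (i + 1), (if min y q = j then 1 else 0) * u (i - j) := by
    intro y
    simp only [ite_mul, one_mul, zero_mul, nextStock, Finset.sum_ite_eq, Finset.mem_range]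
    by_cases h : i < min y q
    · rw [if_pos h, if_pos h, if_neg (by omega), add_zero]
    · rw [if_neg h, if_neg h, if_pos (by omega), zero_add]
  simp only [h]
  have hi : ∀ j ∈ Finset.range (i + 1), Integrable (fun y =>
      (if min y q = j then (1 : ℝ) else 0) * u (i - j)) (poissonMeasure μ) := fun j _ =>
    (integrable_comp_min fun y => if y = j then (1 : ℝ) else 0).mul_const _
  rw [integral_add ((integrable_comp_min fun y => if i < y then (1 : ℝ) else 0).mul_const _)
    (integrable_finsetSum _ hi), integral_finsetSum _ hi, integral_mul_const, shortageProb]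
  congr 1
  refine Finset.sum_congr rfl fun j _ => ?_
  rw [integral_mul_const, integral_indicator_min]

/-- The long-run average cost. -/
noncomputable def averageCost (c : CostParams) (r T : ℝ≥0) (q Q : ℕ) : ℝ :=
  r * (c.cR + c.cD)
    + r * c.AR / (renewalFun (r * T) q Q * truncMean (r * T) q)
    + r * c.AD / truncMean (r * T) q
    + c.h * (∑ i ∈ Finset.range (Q + 1), ((Q : ℝ) - (i : ℝ)) * renewalMass (r * T) q i)
        / renewalFun (r * T) q Q
    + c.w * truncFactorialMoment (r * T) q / (2 * truncMean (r * T) q)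

/-- The solution of the Poisson equation of the inventory chain: up to a constant, the negative
of the relative value of `i` units on hand. -/
noncomputable def potential (c : CostParams) (r T : ℝ≥0) (q Q i : ℕ) : ℝ :=
  c.cR * i + (c.AR + c.h * (truncMean (r * T) q / r) * renewalSum (r * T) q Q) /
    renewalFun (r * T) q Q * renewalFun (r * T) q i -
    c.h * (truncMean (r * T) q / r) * renewalSum (r * T) q i

theorem truncMean_pos (hμ : 0 < μ) (hq : 0 < q) : 0 < truncMean μ q := by
  rw [truncMean, integral_pos_iff_support_of_nonneg (fun y => Nat.cast_nonneg _)
    (integrable_comp_min fun y => (y : ℝ))]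
  refine lt_of_lt_of_le ?_ (measure_mono (s := {1}) ?_)
  · have := poissonMeasure_real_singleton_pos 1 hμ
    exact (ENNReal.toReal_pos_iff.1 this).1
  · intro y hy
    rw [Set.mem_singleton_iff] at hy
    subst hy
    simp only [Function.mem_support]
    have : min 1 q ≠ 0 := by omega
    exact_mod_cast this

/-- Clears the denominators: average cost times mean cycle length is an average cost per dispatch,
the form in which it meets the one-step equation. -/
theorem averageCost_mul (c : CostParams) {r T : ℝ≥0} (hr : 0 < r) (hT : 0 < T) (hq : 0 < q) :
    averageCost c r T q Q * (truncMean (r * T) q / r) = c.AD +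
      (c.cD + c.cR) * truncMean (r * T) q +
      (c.AR + c.h * (truncMean (r * T) q / r) * renewalSum (r * T) q Q) /
        renewalFun (r * T) q Q +
      c.w * (truncFactorialMoment (r * T) q / (2 * r)) := by
  have hμ : 0 < r * T := mul_pos hr hT
  rw [averageCost, renewalSum_eq_sum hμ hq]
  have h1 := (truncMean_pos hμ hq).ne'
  have h2 : renewalFun (r * T) q Q ≠ 0 := (one_pos.trans_le (one_le_renewalFun hμ hq Q)).ne'
  have h3 : (r : ℝ) ≠ 0 := by exact_mod_cast hr.ne'
  field_simp
  ring

/-- The Poisson equation. -/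
theorem integral_oneStep (c : CostParams) {r T : ℝ≥0} (hr : 0 < r) (hT : 0 < T) (hq : 0 < q)
    (i : ℕ) :
    ∫ y, (c.AD + (c.cD + c.cR) * ((min y q : ℕ) : ℝ) + c.AR * (if i < min y q then 1 else 0) +
      c.cR * ((nextStock Q i (min y q) : ℝ) - i) -
      (potential c r T q Q (nextStock Q i (min y q)) - potential c r T q Q i))
      ∂(poissonMeasure (r * T)) + (c.h * i - averageCost c r T q Q) * (truncMean (r * T) q / r) +
      c.w * (truncFactorialMoment (r * T) q / (2 * r)) = 0 := by
  have hμ : 0 < r * T := mul_pos hr hT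
  set ℓ := truncMean (r * T) q / r
  -- The coefficient for which `AR - α * M_G(Q) + h ℓ R(Q) = 0`, so that the shortage probability
  -- drops out. The renewal equations then reduce `α M_G` to the constant `α` and `h ℓ R` to `h ℓ
  -- i`, which cancels the mean holding cost.
  set α := (c.AR + c.h * ℓ * renewalSum (r * T) q Q) / renewalFun (r * T) q Q with hα
  have hM : renewalFun (r * T) q Q ≠ 0 := (one_pos.trans_le (one_le_renewalFun hμ hq Q)).ne'
  have hαM : α * renewalFun (r * T) q Q = c.AR + c.h * ℓ * renewalSum (r * T) q Q := by
    rw [hα, div_mul_cancel₀ _ hM]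
  have e : ∀ y, c.AD + (c.cD + c.cR) * ((min y q : ℕ) : ℝ) +
      c.AR * (if i < min y q then 1 else 0) +
      c.cR * ((nextStock Q i (min y q) : ℝ) - i) -
      (potential c r T q Q (nextStock Q i (min y q)) - potential c r T q Q i) =
      (c.AD + α * renewalFun (r * T) q i - c.h * ℓ * renewalSum (r * T) q i) +
      (c.cD + c.cR) * ((min y q : ℕ) : ℝ) +
      c.AR * (if i < min y q then 1 else 0) +
      (-α) * renewalFun (r * T) q (nextStock Q i (min y q)) +
      c.h * ℓ * renewalSum (r * T) q (nextStock Q i (min y q)) := by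
    intro y
    simp only [potential]
    ring
  simp only [e]
  have i1 := (integrable_comp_min (μ := r * T) (q := q) fun y => (y : ℝ)).const_mul (c.cD + c.cR)
  have i2 := (integrable_comp_min (μ := r * T) (q := q)
    fun y => if i < y then (1 : ℝ) else 0).const_mul c.AR
  have i3 := (integrable_comp_min (μ := r * T) (q := q)
    fun y => renewalFun (r * T) q (nextStock Q i y)).const_mul (-α)
  have i4 := (integrable_comp_min (μ := r * T) (q := q)
    fun y => renewalSum (r * T) q (nextStock Q i y)).const_mul (c.h * ℓ)
  have i0 := integrable_const (μ := poissonMeasure (r * T))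
    (c.AD + α * renewalFun (r * T) q i - c.h * ℓ * renewalSum (r * T) q i)
  rw [integral_add (((i0.fun_add i1).fun_add i2).fun_add i3) i4,
    integral_add ((i0.fun_add i1).fun_add i2) i3,
    integral_add (i0.fun_add i1) i2, integral_add i0 i1, integral_const_mul, integral_const_mul,
    integral_const_mul, integral_const_mul, integral_nextStock, integral_nextStock]
  have e1 : ∫ y, ((min y q : ℕ) : ℝ) ∂(poissonMeasure (r * T)) = truncMean (r * T) q := rfl
  have e2 : ∫ y, (if i < min y q then (1 : ℝ) else 0) ∂(poissonMeasure (r * T)) =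
    shortageProb (r * T) q i := rfl
  have h1 := renewalFun_eq hμ hq i
  have h2 := renewalSum_eq hμ hq i
  have h3 := averageCost_mul (Q := Q) c hr hT hq
  simp only [e1, e2, integral_const, probReal_univ, one_smul]
  generalize ∑ y ∈ Finset.range (i + 1), truncPMF (r * T) q y * renewalFun (r * T) q (i - y) = a
    at *
  generalize ∑ y ∈ Finset.range (i + 1), truncPMF (r * T) q y * renewalSum (r * T) q (i - y) = b
    at *
  rw [h1, h2]
  rw [sub_mul, h3]
  linear_combination (-shortageProb (r * T) q i) * hαM

end OneStep

/-! ### Compensated cycle costs have conditional mean zero -/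

section Compensated

variable {Ω : Type*} [MeasurableSpace Ω] {P : Measure Ω} [IsProbabilityMeasure P]
  {N : ℝ≥0 → Ω → ℕ} {r : ℝ≥0} {q : ℕ} {T : ℝ≥0} {Q : ℕ} {k : ℕ} {F : Set Ω}

theorem IsPoissonProcess.integrable_cycleLength (hN : IsPoissonProcess N r P) (k : ℕ) :
    Integrable (fun ω => cycleLength q T (fun t => N t ω) k) P :=
  Integrable.of_bound (hN.measurable_cycleLength k).aestronglyMeasurable T
    (Eventually.of_forall fun ω => by
      rw [Real.norm_eq_abs, abs_of_nonneg (cycleLength_nonneg (hN.isDemandPath ω) k)]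
      exact cycleLength_le (hN.isDemandPath ω) k)

theorem IsPoissonProcess.integrable_cycleWaiting (hN : IsPoissonProcess N r P) (hq : 0 < q)
    (hT : 0 < T) (k : ℕ) : Integrable (fun ω => cycleWaiting q T (fun t => N t ω) k) P :=
  Integrable.of_bound (hN.measurable_cycleWaiting k).aestronglyMeasurable (q * T) (by
    filter_upwards [hN.ae_hasUnitJumps] with ω hω
    exact abs_cycleWaiting_le (hN.isDemandPath ω) hω hq hT k)

theorem IsPoissonProcess.integrable_cycleCost (hN : IsPoissonProcess N r P) (hq : 0 < q)
    (hT : 0 < T) (c : CostParams) (k : ℕ) :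
    Integrable (fun ω => cycleCost c q T Q (fun t => N t ω) k) P :=
  Integrable.of_bound (hN.measurable_cycleCost c k).aestronglyMeasurable
    (cycleCostBound c q T Q) (by
    filter_upwards [hN.ae_hasUnitJumps] with ω hω
    exact abs_cycleCost_le (hN.isDemandPath ω) hω hq hT k)

theorem abs_comp_onHand_le (v : ℕ → ℝ) (n : ℝ≥0 → ℕ) (k : ℕ) :
    |v (onHand q T Q n k)| ≤ ∑ j ∈ Finset.range (Q + 1), |v j| :=
  Finset.single_le_sum (f := fun j => |v j|) (fun _ _ => abs_nonneg _)
    (Finset.mem_range.2 (Nat.lt_succ_of_le (onHand_le k)))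

theorem IsPoissonProcess.integrable_comp_onHand (hN : IsPoissonProcess N r P) (v : ℕ → ℝ)
    (k : ℕ) : Integrable (fun ω => v (onHand q T Q (fun t => N t ω) k)) P :=
  Integrable.of_bound (hN.measurable_comp_onHand v k).aestronglyMeasurable _
    (Eventually.of_forall fun _ => abs_comp_onHand_le v _ k)

theorem IsPoissonProcess.integrable_comp_cycleLoad (hN : IsPoissonProcess N r P) (hq : 0 < q)
    (hT : 0 < T) (f : ℕ → ℝ) (k : ℕ) :
    Integrable (fun ω => f (cycleLoad q T (fun t => N t ω) k)) P :=
  Integrable.of_bound ((Measurable.of_discrete (f := f)).comp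
    (measurable_cycleLoad hN.measurable hN.isDemandPath k)).aestronglyMeasurable
    (∑ j ∈ Finset.range (q + 1), |f j|) (by
      filter_upwards [hN.ae_hasUnitJumps] with ω hω
      rw [cycleLoad_eq_min (hN.isDemandPath ω) hω hq hT]
      exact abs_comp_min_le f q _)

/-- The cost of cycle `k`, compensated by the average cost and by the change of the potential,
has mean zero given the past. -/
theorem IsPoissonProcess.setIntegral_cycleCost_sub (hN : IsPoissonProcess N r P) (hr : 0 < r)
    (hq : 0 < q) (hT : 0 < T) (c : CostParams) (hF : IsDispatchEvent N q T k F) :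
    ∫ ω in F, (cycleCost c q T Q (fun t => N t ω) k -
      averageCost c r T q Q * cycleLength q T (fun t => N t ω) k -
      (potential c r T q Q (onHand q T Q (fun t => N t ω) (k + 1)) -
        potential c r T q Q (onHand q T Q (fun t => N t ω) k))) ∂P = 0 := by
  have hint : Integrable (fun ω => cycleCost c q T Q (fun t => N t ω) k -
      averageCost c r T q Q * cycleLength q T (fun t => N t ω) k -
      (potential c r T q Q (onHand q T Q (fun t => N t ω) (k + 1)) -
        potential c r T q Q (onHand q T Q (fun t => N t ω) k))) P :=
    ((hN.integrable_cycleCost hq hT c k).sub ((hN.integrable_cycleLength k).const_mul _)).sub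
      ((hN.integrable_comp_onHand _ (k + 1)).sub (hN.integrable_comp_onHand _ k))
  have hevent : ∀ i, IsDispatchEvent N q T k
      (F ∩ {ω | onHand q T Q (fun t => N t ω) k = i}) := fun i =>
    hF.inter (hN.isDispatchEvent k (p := fun _ y _ => y = i)
      ((measurable_fst.comp measurable_snd) (measurableSet_singleton i)))
  -- With the stock fixed at `i`, the integrand is a function of the load plus multiples of length
  -- and waiting time, whose means given the past are known.
  have hU : F = ⋃ i ∈ Finset.range (Q + 1), (F ∩ {ω | onHand q T Q (fun t => N t ω) k = i}) := by
    ext ω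
    simp only [Set.mem_iUnion, Set.mem_inter_iff, Set.mem_ofPred_eq, Finset.mem_range]
    constructor
    · intro h
      exact ⟨_, Nat.lt_succ_of_le (onHand_le k), h, rfl⟩
    · rintro ⟨_, _, h, _⟩
      exact h
  rw [hU, integral_biUnion_finset _ (fun i _ => (hevent i).1) _ fun i _ => hint.integrableOn]
  · refine Finset.sum_eq_zero fun i _ => ?_
    set ψ : ℕ → ℝ := fun L => c.AD + (c.cD + c.cR) * (L : ℝ) + c.AR * (if i < L then 1 else 0) +
      c.cR * ((nextStock Q i L : ℝ) - i) -
      (potential c r T q Q (nextStock Q i L) - potential c r T q Q i) with hψ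
    have hcongr : ∀ ω ∈ F ∩ {ω | onHand q T Q (fun t => N t ω) k = i},
        cycleCost c q T Q (fun t => N t ω) k -
        averageCost c r T q Q * cycleLength q T (fun t => N t ω) k -
        (potential c r T q Q (onHand q T Q (fun t => N t ω) (k + 1)) -
          potential c r T q Q (onHand q T Q (fun t => N t ω) k)) =
        ψ (cycleLoad q T (fun t => N t ω) k) +
        (c.h * i - averageCost c r T q Q) * cycleLength q T (fun t => N t ω) k +
        c.w * cycleWaiting q T (fun t => N t ω) k := by
      rintro ω ⟨_, hω⟩
      rw [Set.mem_ofPred_eq] at hω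
      have h1 : onHand q T Q (fun t => N t ω) (k + 1) =
          nextStock Q i (cycleLoad q T (fun t => N t ω) k) := by
        rw [onHand, hω, nextStock]
      rw [cycleCost, dispatchCost_eq, h1, hω]
      simp only [hψ]
      ring
    rw [setIntegral_congr_fun (hevent i).1 hcongr]
    have i1 := (hN.integrable_comp_cycleLoad hq hT ψ k).integrableOn
      (s := F ∩ {ω | onHand q T Q (fun t => N t ω) k = i})
    have i2 := ((hN.integrable_cycleLength (q := q) (T := T) k).const_mul
      (c.h * i - averageCost c r T q Q)).integrableOn
      (s := F ∩ {ω | onHand q T Q (fun t => N t ω) k = i})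
    have i3 := ((hN.integrable_cycleWaiting hq hT k).const_mul c.w).integrableOn
      (s := F ∩ {ω | onHand q T Q (fun t => N t ω) k = i})
    rw [integral_add (Integrable.fun_add i1 i2) i3, integral_add i1 i2, integral_const_mul,
      integral_const_mul, hN.setIntegral_cycleLoad hq hT (hevent i),
      hN.setIntegral_cycleLength hr (hevent i), hN.setIntegral_cycleWaiting hr (hevent i)]
    have := integral_oneStep (Q := Q) c hr hT hq i
    simp only [hψ]
    linear_combination (P.real (F ∩ {ω | onHand q T Q (fun t => N t ω) k = i})) * this
  · intro i _ j _ hij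
    rw [Function.onFun, Set.disjoint_left]
    rintro ω ⟨_, h1⟩ ⟨_, h2⟩
    exact hij (h1.symm.trans h2)

end Compensated

/-! ### Sums up to a random index -/

section RandomSum

variable {Ω : Type*} [MeasurableSpace Ω] {P : Measure Ω} [IsProbabilityMeasure P]

/-- Sums of bounded random variables up to a random index. -/
theorem integrable_randomSum {κ : Ω → ℕ} {A : ℕ → Set Ω} (hA : ∀ k, MeasurableSet (A k))
    (hκ : ∀ᵐ ω ∂P, ∀ k, k < κ ω ↔ ω ∈ A k) (hs : Summable fun k => P.real (A k))
    {X : ℕ → Ω → ℝ} (hX : ∀ k, Measurable (X k)) {B : ℝ}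
    (hB : ∀ᵐ ω ∂P, ∀ k, |X k ω| ≤ B) :
    Integrable (fun ω => ∑ k ∈ Finset.range (κ ω), X k ω) P ∧
      HasSum (fun k => ∫ ω in A k, X k ω ∂P) (∫ ω, ∑ k ∈ Finset.range (κ ω), X k ω ∂P) := by
  have hB0 : ∀ k, ∀ᵐ ω ∂P, ‖(A k).indicator (X k) ω‖ ≤ (A k).indicator (fun _ => B) ω := by
    intro k
    filter_upwards [hB] with ω hω
    rw [norm_indicator_eq_indicator_norm]
    exact Set.indicator_le_indicator (hω k)
  have hBi : ∀ k, Integrable ((A k).indicator fun _ => B) P := fun k =>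
    (integrable_const B).indicator (hA k)
  have hint : ∀ k, Integrable ((A k).indicator (X k)) P := fun k =>
    (hBi k).mono' ((hX k).indicator (hA k)).aestronglyMeasurable (hB0 k)
  have hsum : Summable fun k => ∫ ω, ‖(A k).indicator (X k) ω‖ ∂P := by
    refine Summable.of_nonneg_of_le (fun k => integral_nonneg fun _ => norm_nonneg _)
      (fun k => ?_) (hs.mul_right B)
    refine (integral_mono_ae (hint k).norm (hBi k) (hB0 k)).trans (le_of_eq ?_)
    rw [integral_indicator (hA k)]
    simp
  -- The random sum is a series of indicator terms with norms at most `B * P(A k)` in `L¹`, so it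
  -- can be integrated term by term.
  have heq : ∀ᵐ ω ∂P, (∑' k, (A k).indicator (X k) ω) = ∑ k ∈ Finset.range (κ ω), X k ω ∧
      Tendsto (fun n => ∑ k ∈ Finset.range n, (A k).indicator (X k) ω) atTop
        (𝓝 (∑ k ∈ Finset.range (κ ω), X k ω)) := by
    filter_upwards [hκ] with ω hω
    have h : HasSum (fun k => (A k).indicator (X k) ω) (∑ k ∈ Finset.range (κ ω), X k ω) := by
      have h1 : HasSum (fun k => (A k).indicator (X k) ω)
          (∑ k ∈ Finset.range (κ ω), (A k).indicator (X k) ω) :=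
        hasSum_sum_of_ne_finset_zero fun k hk => by
          rw [Set.indicator_of_notMem]
          rwa [← hω k, ← Finset.mem_range]
      convert! h1 using 1
      refine Finset.sum_congr rfl fun k hk => ?_
      rw [Set.indicator_of_mem ((hω k).1 (Finset.mem_range.1 hk))]
    exact ⟨h.tsum_eq, h.tendsto_sum_nat⟩
  constructor
  · refine ⟨aestronglyMeasurable_of_tendsto_ae atTop (fun n =>
      (Finset.measurable_sum (Finset.range n) fun k _ =>
        (hX k).indicator (hA k)).aestronglyMeasurable) (heq.mono fun ω h => ?_), ?_⟩
    · simpa only [Finset.sum_apply] using h.2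
    · have hle : ∀ᵐ ω ∂P, ‖∑ k ∈ Finset.range (κ ω), X k ω‖ₑ ≤
          ∑' k, ‖(A k).indicator (X k) ω‖ₑ := by
        filter_upwards [hκ] with ω hω
        refine (enorm_sum_le _ _).trans ((Finset.sum_le_sum fun k hk => ?_).trans
          (ENNReal.sum_le_tsum (Finset.range (κ ω))))
        rw [Set.indicator_of_mem ((hω k).1 (Finset.mem_range.1 hk))]
      refine (lintegral_mono_ae hle).trans_lt ?_
      rw [lintegral_tsum fun k => (hint k).1.enorm]
      have : ∀ k, ∫⁻ ω, ‖(A k).indicator (X k) ω‖ₑ ∂P =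
          ENNReal.ofReal (∫ ω, ‖(A k).indicator (X k) ω‖ ∂P) := fun k =>
        (ofReal_integral_norm_eq_lintegral_enorm (hint k)).symm
      simp only [this]
      rw [← ENNReal.ofReal_tsum_of_nonneg (fun k => integral_nonneg fun _ => norm_nonneg _) hsum]
      exact ENNReal.ofReal_lt_top
  · have h := hasSum_integral_of_summable_integral_norm hint hsum
    rw [integral_congr_ae (heq.mono fun ω h => h.1)] at h
    simpa only [integral_indicator (hA _)] using h

end RandomSum

/-! ### Wald's identity for the cost -/

section Wald

variable {Ω : Type*} [MeasurableSpace Ω] {P : Measure Ω} [IsProbabilityMeasure P]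
  {N : ℝ≥0 → Ω → ℕ} {r : ℝ≥0} {q : ℕ} {T : ℝ≥0} {Q : ℕ}

theorem sum_cycleLength (n : ℝ≥0 → ℕ) (k : ℕ) :
    ∑ j ∈ Finset.range k, cycleLength q T n j = dispatchTime q T n k := by
  simp only [cycleLength]
  rw [Finset.sum_range_sub (fun j => (dispatchTime q T n j : ℝ))]
  simp [dispatchTime]

/-- The expected cost up to a random dispatch `κ` that does not anticipate the future. -/
theorem IsPoissonProcess.integral_sum_cycleCost (hN : IsPoissonProcess N r P) (hr : 0 < r)
    (hq : 0 < q) (hT : 0 < T) (c : CostParams) {κ : Ω → ℕ} {A : ℕ → Set Ω}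
    (hA : ∀ k, IsDispatchEvent N q T k (A k))
    (hκ : ∀ᵐ ω ∂P, ∀ k, k < κ ω ↔ ω ∈ A k) (hs : Summable fun k => P.real (A k)) :
    Integrable (fun ω => ∑ k ∈ Finset.range (κ ω), cycleCost c q T Q (fun t => N t ω) k) P ∧
    Integrable (fun ω => (dispatchTime q T (fun t => N t ω) (κ ω) : ℝ)) P ∧
    Integrable (fun ω => potential c r T q Q (onHand q T Q (fun t => N t ω) (κ ω))) P ∧
    ∫ ω, ∑ k ∈ Finset.range (κ ω), cycleCost c q T Q (fun t => N t ω) k ∂P =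
      averageCost c r T q Q * ∫ ω, (dispatchTime q T (fun t => N t ω) (κ ω) : ℝ) ∂P +
      (∫ ω, potential c r T q Q (onHand q T Q (fun t => N t ω) (κ ω)) ∂P -
        potential c r T q Q Q) := by
  set v := potential c r T q Q
  have mC := fun k => hN.measurable_cycleCost (q := q) (T := T) (Q := Q) c k
  have mL := fun k => hN.measurable_cycleLength (q := q) (T := T) k
  have mV : ∀ k, Measurable fun ω => v (onHand q T Q (fun t => N t ω) (k + 1)) -
      v (onHand q T Q (fun t => N t ω) k) := fun k =>
    (hN.measurable_comp_onHand v (k + 1)).sub (hN.measurable_comp_onHand v k)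
  have bC : ∀ᵐ ω ∂P, ∀ k, |cycleCost c q T Q (fun t => N t ω) k| ≤ cycleCostBound c q T Q := by
    filter_upwards [hN.ae_hasUnitJumps] with ω hω k
    exact abs_cycleCost_le (hN.isDemandPath ω) hω hq hT k
  have bL : ∀ᵐ ω ∂P, ∀ k, |cycleLength q T (fun t => N t ω) k| ≤ T :=
    Eventually.of_forall fun ω k => by
      rw [abs_of_nonneg (cycleLength_nonneg (hN.isDemandPath ω) k)]
      exact cycleLength_le (hN.isDemandPath ω) k
  have bV : ∀ᵐ ω ∂P, ∀ k, |v (onHand q T Q (fun t => N t ω) (k + 1)) -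
      v (onHand q T Q (fun t => N t ω) k)| ≤
      ∑ j ∈ Finset.range (Q + 1), |v j| + ∑ j ∈ Finset.range (Q + 1), |v j| :=
    Eventually.of_forall fun ω k => (abs_sub _ _).trans
      (add_le_add (abs_comp_onHand_le v _ _) (abs_comp_onHand_le v _ _))
  have hA' := fun k => (hA k).1
  obtain ⟨iC, sC⟩ := integrable_randomSum hA' hκ hs mC bC
  obtain ⟨iL, sL⟩ := integrable_randomSum hA' hκ hs mL bL
  obtain ⟨iV, sV⟩ := integrable_randomSum hA' hκ hs mV bV
  -- The changes of the potential telescope from the initial stock `Q` to the stock at `κ`.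
  have eV : ∀ ω, ∑ k ∈ Finset.range (κ ω), (v (onHand q T Q (fun t => N t ω) (k + 1)) -
      v (onHand q T Q (fun t => N t ω) k)) = v (onHand q T Q (fun t => N t ω) (κ ω)) - v Q :=
    fun ω => Finset.sum_range_sub (fun j => v (onHand q T Q (fun t => N t ω) j)) _
  simp only [eV] at iV sV
  simp only [sum_cycleLength] at iL sL
  have iV' : Integrable (fun ω => v (onHand q T Q (fun t => N t ω) (κ ω))) P := by
    refine (Integrable.fun_add iV (integrable_const (v Q))).congr (Eventually.of_forall fun ω => ?_)
    exact sub_add_cancel _ _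
  refine ⟨iC, iL, iV', ?_⟩
  have hzero : ∀ k, ∫ ω in A k, cycleCost c q T Q (fun t => N t ω) k ∂P -
      averageCost c r T q Q * ∫ ω in A k, cycleLength q T (fun t => N t ω) k ∂P -
      ∫ ω in A k, (v (onHand q T Q (fun t => N t ω) (k + 1)) -
        v (onHand q T Q (fun t => N t ω) k)) ∂P = 0 := by
    intro k
    have i1 := (hN.integrable_cycleCost (Q := Q) hq hT c k).integrableOn (s := A k)
    have i2 := ((hN.integrable_cycleLength (q := q) (T := T) k).const_mul
      (averageCost c r T q Q)).integrableOn (s := A k)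
    have i12 : IntegrableOn (fun ω => cycleCost c q T Q (fun t => N t ω) k -
        averageCost c r T q Q * cycleLength q T (fun t => N t ω) k) (A k) P := Integrable.sub i1 i2
    have i3 : IntegrableOn (fun ω => v (onHand q T Q (fun t => N t ω) (k + 1)) -
        v (onHand q T Q (fun t => N t ω) k)) (A k) P :=
      ((hN.integrable_comp_onHand v (k + 1)).sub (hN.integrable_comp_onHand v k)).integrableOn
    rw [← integral_const_mul, ← integral_sub i1 i2, ← integral_sub i12 i3]
    exact hN.setIntegral_cycleCost_sub hr hq hT c (hA k)
  have h := (sC.sub (sL.mul_left (averageCost c r T q Q))).sub sV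
  simp only [hzero] at h
  have := h.unique hasSum_zero
  rw [integral_sub iV' (integrable_const _), integral_const, probReal_univ, one_smul] at this
  linarith

end Wald

/-! ### Expected cost up to time `t` -/

section LongRun

variable {Ω : Type*} [MeasurableSpace Ω] {P : Measure Ω}
  {N : ℝ≥0 → Ω → ℕ} {r : ℝ≥0} {q : ℕ} {T : ℝ≥0} {Q : ℕ}

theorem integrable_natCast_poissonMeasure (μ : ℝ≥0) :
    Integrable (fun y : ℕ => (y : ℝ)) (poissonMeasure μ) := by
  rw [integrable_poissonMeasure_iff, ← summable_nat_add_iff 1]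
  refine ((Real.summable_pow_div_factorial μ).mul_left (Real.exp (-μ) * μ)).congr fun j => ?_
  rw [Real.norm_natCast, Nat.factorial_succ]
  push_cast
  field_simp
  ring

theorem IsPoissonProcess.integrable_natCast (hN : IsPoissonProcess N r P) (t : ℝ≥0) :
    Integrable (fun ω => (N t ω : ℝ)) P := by
  have h := hN.law_increment 0 t
  simp only [zero_add, hN.zero, Nat.sub_zero] at h
  have h2 := integrable_natCast_poissonMeasure (r * t)
  rw [← h.map_eq, integrable_map_measure .of_discrete h.aemeasurable] at h2
  exact h2

theorem IsPoissonProcess.measurable_dispatchCount (hN : IsPoissonProcess N r P) (hq : 0 < q)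
    (hT : 0 < T) :
    Measurable fun p : Ω × ℝ => dispatchCount q T (fun t => N t p.1) p.2.toNNReal := by
  refine measurable_of_Ici fun k => ?_
  have : (fun p : Ω × ℝ => dispatchCount q T (fun t => N t p.1) p.2.toNNReal) ⁻¹' Set.Ici k =
      {p | dispatchTime q T (fun t => N t p.1) k ≤ p.2.toNNReal} := by
    ext p
    exact le_dispatchCount_iff (hN.isDemandPath p.1) hq hT
  rw [this]
  exact measurableSet_le ((measurable_dispatchTime hN.measurable hN.isDemandPath k).comp
    measurable_fst) measurable_snd.real_toNNReal

theorem measurable_sum_range {κ : Ω → ℕ} (hκ : Measurable κ) {X : ℕ → Ω → ℝ}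
    (hX : ∀ k, Measurable (X k)) : Measurable fun ω => ∑ k ∈ Finset.range (κ ω), X k ω := by
  have h : Measurable fun x : ℕ × Ω => ∑ k ∈ Finset.range x.1, X k x.2 :=
    measurable_from_prod_countable_right fun j =>
      Finset.measurable_sum (Finset.range j) fun k _ => hX k
  exact h.comp (hκ.prodMk measurable_id)

theorem IsPoissonProcess.measurable_totalCost (hN : IsPoissonProcess N r P) (hq : 0 < q)
    (hT : 0 < T) (c : CostParams) (t : ℝ≥0) :
    Measurable fun ω => totalCost c q T Q (fun s => N s ω) t := by
  have hD := hN.measurable_dispatchCount (q := q) (T := T) hq hT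
  have hI : Measurable fun p : Ω × ℝ =>
      (inventoryLevel q T Q (fun t => N t p.1) p.2.toNNReal : ℝ) := by
    have h : Measurable fun x : ℕ × Ω => (onHand q T Q (fun t => N t x.2) x.1 : ℝ) :=
      measurable_from_prod_countable_right fun k =>
        hN.measurable_comp_onHand (q := q) (T := T) (Q := Q) (fun y => (y : ℝ)) k
    exact h.comp (hD.prodMk measurable_fst)
  have hW : Measurable fun p : Ω × ℝ =>
      (waitingLoad q T (fun t => N t p.1) p.2.toNNReal : ℝ) := by
    have h : Measurable fun x : ℕ × Ω => dispatchTime q T (fun t => N t x.2) x.1 :=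
      measurable_from_prod_countable_right fun k =>
        measurable_dispatchTime (q := q) (T := T) hN.measurable hN.isDemandPath k
    have hu := measurable_uncurry_of_rightCont hN.measurable hN.isDemandPath
    have h2 : Measurable fun p : Ω × ℝ => waitingLoad q T (fun t => N t p.1) p.2.toNNReal :=
      (hu.comp (measurable_snd.real_toNNReal.prodMk measurable_fst)).sub
        (hu.comp ((h.comp (hD.prodMk measurable_fst)).prodMk measurable_fst))
    exact (Measurable.of_discrete (f := fun y : ℕ => (y : ℝ))).comp h2
  have hS : Measurable fun ω => ∑ k ∈ Finset.range (dispatchCount q T (fun s => N s ω) t),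
      dispatchCost c q T Q (fun s => N s ω) k := by
    have hD' : Measurable fun ω => dispatchCount q T (fun s => N s ω) t := by
      have h1 : Measurable fun ω : Ω => (ω, (t : ℝ)) := measurable_id.prodMk measurable_const
      have h2 := hD.comp h1
      simp only [Function.comp_def, Real.toNNReal_coe] at h2
      exact h2
    exact measurable_sum_range hD' fun k => hN.measurable_dispatchCost c k
  have hI' : Measurable fun ω => ∫ s in Set.Ioc (0 : ℝ) t,
      (inventoryLevel q T Q (fun t => N t ω) s.toNNReal : ℝ) :=
    hI.stronglyMeasurable.integral_prod_right'.measurable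
  have hW' : Measurable fun ω => ∫ s in Set.Ioc (0 : ℝ) t,
      (waitingLoad q T (fun t => N t ω) s.toNNReal : ℝ) :=
    hW.stronglyMeasurable.integral_prod_right'.measurable
  simp only [totalCost, intervalIntegral.integral_of_le t.coe_nonneg]
  exact (hS.add (hI'.const_mul c.h)).add (hW'.const_mul c.w)

theorem IsPoissonProcess.isDispatchEvent_replenishCount_lt (hN : IsPoissonProcess N r P)
    (m k : ℕ) :
    IsDispatchEvent N q T k {ω | replenishCount q T Q (fun s => N s ω) k < m} :=
  hN.isDispatchEvent k (p := fun _ _ z => z < m)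
    (measurableSet_lt (measurable_snd.comp measurable_snd) measurable_const)

variable [IsProbabilityMeasure P]

/-- The series is the mean of the number of dispatches up to `t`, plus `1` for dispatch `0`, which
is at most `E[N t] + t / T + 1`. -/
theorem IsPoissonProcess.summable_dispatchTime_le (hN : IsPoissonProcess N r P) (hq : 0 < q)
    (hT : 0 < T) (t : ℝ≥0) :
    Summable fun k => P.real {ω | dispatchTime q T (fun s => N s ω) k ≤ t} := by
  have hm : ∀ k, MeasurableSet {ω | dispatchTime q T (fun s => N s ω) k ≤ t} := fun k =>
    measurableSet_le (measurable_dispatchTime hN.measurable hN.isDemandPath k) measurable_const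
  have hi : Integrable (fun ω => (N t ω : ℝ) + ((t : ℝ) / T + 1)) P :=
    (hN.integrable_natCast t).add (integrable_const _)
  refine summable_of_sum_range_le (c := ∫ ω, ((N t ω : ℝ) + ((t : ℝ) / T + 1)) ∂P)
    (fun _ => measureReal_nonneg) fun n => ?_
  have h1 : ∀ k ∈ Finset.range n, Integrable
      ({ω | dispatchTime q T (fun s => N s ω) k ≤ t}.indicator (fun _ => (1 : ℝ))) P :=
    fun k _ => (integrable_const 1).indicator (hm k)
  calc ∑ k ∈ Finset.range n, P.real {ω | dispatchTime q T (fun s => N s ω) k ≤ t}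
      = ∫ ω, ∑ k ∈ Finset.range n,
          {ω | dispatchTime q T (fun s => N s ω) k ≤ t}.indicator (fun _ => (1 : ℝ)) ω ∂P := by
        rw [integral_finsetSum _ h1]
        refine Finset.sum_congr rfl fun k _ => ?_
        rw [integral_indicator (hm k)]
        simp
    _ ≤ _ := by
        refine integral_mono (integrable_finsetSum _ h1) hi fun ω => ?_
        have h2 : ∑ k ∈ Finset.range n,
            {ω | dispatchTime q T (fun s => N s ω) k ≤ t}.indicator (fun _ => (1 : ℝ)) ω =
            ((Finset.range n).filter fun k =>
              dispatchTime q T (fun s => N s ω) k ≤ t).card := by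
          rw [Finset.card_filter]
          push_cast
          rfl
        have h3 : ((Finset.range n).filter fun k =>
            dispatchTime q T (fun s => N s ω) k ≤ t).card ≤
            dispatchCount q T (fun s => N s ω) t + 1 := by
          rw [← Finset.card_range (dispatchCount q T (fun s => N s ω) t + 1)]
          refine Finset.card_le_card fun k hk => ?_
          have := (le_dispatchCount_iff (hN.isDemandPath ω) hq hT).2 (Finset.mem_filter.1 hk).2
          exact Finset.mem_range.2 (by omega)
        have h4 := dispatchCount_le (hN.isDemandPath ω) hq hT t
        have h5 : (((Finset.range n).filter fun k =>
            dispatchTime q T (fun s => N s ω) k ≤ t).card : ℝ) ≤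
            dispatchCount q T (fun s => N s ω) t + 1 := by exact_mod_cast h3
        simp only [h2]
        linarith

/-- The expected total cost differs from the linear function with slope `averageCost` by a
bounded amount. -/
theorem IsPoissonProcess.integrable_totalCost (hN : IsPoissonProcess N r P) (hr : 0 < r)
    (hq : 0 < q) (hT : 0 < T) (c : CostParams) :
    (∀ t, Integrable (fun ω => totalCost c q T Q (fun s => N s ω) t) P) ∧
    ∃ K, ∀ t : ℝ≥0, |∫ ω, totalCost c q T Q (fun s => N s ω) t ∂P -
      averageCost c r T q Q * t| ≤ K := by
  set V := ∑ j ∈ Finset.range (Q + 1), |potential c r T q Q j|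
  have main : ∀ t, Integrable (fun ω => totalCost c q T Q (fun s => N s ω) t) P ∧
      |∫ ω, totalCost c q T Q (fun s => N s ω) t ∂P - averageCost c r T q Q * t| ≤
        2 * cycleCostBound c q T Q + (|averageCost c r T q Q| * T + (V + V)) := by
    intro t
    -- The first dispatch after `t`, which is a stopping index; the last one before `t` is not. Its
    -- time exceeds `t` by at most `T`.
    set κ : Ω → ℕ := fun ω => dispatchCount q T (fun s => N s ω) t + 1
    have hκ : ∀ᵐ ω ∂P, ∀ k, k < κ ω ↔ ω ∈ {ω | dispatchTime q T (fun s => N s ω) k ≤ t} :=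
      Eventually.of_forall fun ω k => by
        rw [Set.mem_ofPred_eq, ← le_dispatchCount_iff (hN.isDemandPath ω) hq hT]
        exact Nat.lt_succ_iff
    obtain ⟨i1, i2, i3, e⟩ := hN.integral_sum_cycleCost (Q := Q) hr hq hT c
      (fun k => hN.isDispatchEvent (Q := Q) k (p := fun x _ _ => x ≤ t)
        (measurableSet_le measurable_fst measurable_const)) hκ
      (hN.summable_dispatchTime_le hq hT t)
    have hb : ∀ᵐ ω ∂P, ‖totalCost c q T Q (fun s => N s ω) t -
        ∑ k ∈ Finset.range (κ ω), cycleCost c q T Q (fun s => N s ω) k‖ ≤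
        2 * cycleCostBound c q T Q := by
      filter_upwards [hN.ae_hasUnitJumps] with ω hω
      exact abs_totalCost_sub_le (hN.isDemandPath ω) hω hq hT t
    have hd : Integrable (fun ω => totalCost c q T Q (fun s => N s ω) t -
        ∑ k ∈ Finset.range (κ ω), cycleCost c q T Q (fun s => N s ω) k) P :=
      Integrable.of_bound ((hN.measurable_totalCost hq hT c t).aestronglyMeasurable.sub
        i1.aestronglyMeasurable) _ hb
    have hi : Integrable (fun ω => totalCost c q T Q (fun s => N s ω) t) P :=
      (Integrable.fun_add hd i1).congr (Eventually.of_forall fun ω => sub_add_cancel _ _)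
    refine ⟨hi, ?_⟩
    have b1 : |∫ ω, totalCost c q T Q (fun s => N s ω) t ∂P -
        ∫ ω, ∑ k ∈ Finset.range (κ ω), cycleCost c q T Q (fun s => N s ω) k ∂P| ≤
        2 * cycleCostBound c q T Q := by
      rw [← integral_sub hi i1]
      simpa using norm_integral_le_of_norm_le_const hb
    have b2 : |∫ ω, (dispatchTime q T (fun s => N s ω) (κ ω) : ℝ) ∂P - t| ≤ T := by
      have : ∫ ω, (dispatchTime q T (fun s => N s ω) (κ ω) : ℝ) ∂P - t =
          ∫ ω, ((dispatchTime q T (fun s => N s ω) (κ ω) : ℝ) - t) ∂P := by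
        rw [integral_sub i2 (integrable_const _)]
        simp
      rw [this]
      have hb2 : ∀ᵐ ω ∂P, ‖(dispatchTime q T (fun s => N s ω) (κ ω) : ℝ) - t‖ ≤ T :=
        Eventually.of_forall fun ω => by
          have h1 := NNReal.coe_lt_coe.2
            (lt_dispatchTime_dispatchCount_succ (hN.isDemandPath ω) hq hT t)
          have h2 := NNReal.coe_le_coe.2 (dispatchTime_succ_le_add (q := q) (T := T)
            (hN.isDemandPath ω) (dispatchCount q T (fun s => N s ω) t))
          have h3 := NNReal.coe_le_coe.2 ((le_dispatchCount_iff (t := t)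
            (hN.isDemandPath ω) hq hT).1 le_rfl)
          push_cast at h2
          rw [Real.norm_eq_abs, abs_le]
          constructor <;> simp only [κ] <;> linarith [T.coe_nonneg]
      simpa using norm_integral_le_of_norm_le_const hb2
    have b3 : |∫ ω, potential c r T q Q (onHand q T Q (fun s => N s ω) (κ ω)) ∂P| ≤ V := by
      have : ∀ᵐ ω ∂P, ‖potential c r T q Q (onHand q T Q (fun s => N s ω) (κ ω))‖ ≤ V :=
        Eventually.of_forall fun ω => abs_comp_onHand_le _ _ _
      simpa using norm_integral_le_of_norm_le_const this
    have b4 : |potential c r T q Q Q| ≤ V :=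
      abs_comp_onHand_le (q := q) (T := T) (Q := Q) (potential c r T q Q) (fun _ => 0) 0
    set X := ∫ ω, totalCost c q T Q (fun s => N s ω) t ∂P
    set Y := ∫ ω, ∑ k ∈ Finset.range (κ ω), cycleCost c q T Q (fun s => N s ω) k ∂P
    set D := ∫ ω, (dispatchTime q T (fun s => N s ω) (κ ω) : ℝ) ∂P
    set W := ∫ ω, potential c r T q Q (onHand q T Q (fun s => N s ω) (κ ω)) ∂P
    have : X - averageCost c r T q Q * t =
        (X - Y) + (averageCost c r T q Q * (D - t) + (W - potential c r T q Q Q)) := by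
      rw [e]; ring
    rw [this]
    refine (abs_add_le _ _).trans (add_le_add b1 ((abs_add_le _ _).trans (add_le_add ?_
      ((abs_sub _ _).trans (add_le_add b3 b4)))))
    rw [abs_mul]
    gcongr
  exact ⟨fun t => (main t).1, _, fun t => (main t).2⟩

theorem IsPoissonProcess.tendsto_totalCost_div (hN : IsPoissonProcess N r P) (hr : 0 < r)
    (hq : 0 < q) (hT : 0 < T) (c : CostParams) :
    Tendsto (fun t : ℝ≥0 => (∫ ω, totalCost c q T Q (fun s => N s ω) t ∂P) / (t : ℝ))
      atTop (𝓝 (averageCost c r T q Q)) := by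
  obtain ⟨_, K, hK⟩ := hN.integrable_totalCost (Q := Q) hr hq hT c
  have ht : Tendsto (fun t : ℝ≥0 => (t : ℝ)) atTop atTop := NNReal.tendsto_coe_atTop.2 tendsto_id
  have hlim : Tendsto (fun t : ℝ≥0 => K / (t : ℝ)) atTop (𝓝 0) := ht.const_div_atTop K
  rw [tendsto_iff_dist_tendsto_zero]
  refine squeeze_zero' (Eventually.of_forall fun _ => dist_nonneg) ?_ hlim
  filter_upwards [eventually_gt_atTop 0] with t ht
  have ht' : (0 : ℝ) < t := by exact_mod_cast ht
  rw [Real.dist_eq, ← mul_div_cancel_right₀ (averageCost c r T q Q) ht'.ne', ← sub_div, abs_div,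
    abs_of_pos ht']
  gcongr
  exact hK t

end LongRun

/-! ### Expected cost and length of replenishment cycles -/

section ReplenishmentCycles

variable {Ω : Type*} [MeasurableSpace Ω] {P : Measure Ω} [IsProbabilityMeasure P]
  {N : ℝ≥0 → Ω → ℕ} {r : ℝ≥0} {q : ℕ} {T : ℝ≥0} {Q : ℕ}

/-- Here `j` is `k` stopped at the dispatch where the replenishment count reaches `m`. The sum
telescopes up to `j`, and the count there has not passed `m`. -/
theorem exists_sum_replenish_eq (v : ℕ → ℝ) (n : ℝ≥0 → ℕ) (m k : ℕ) :
    ∃ j, replenishCount q T Q n j ≤ m ∧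
      (∑ i ∈ Finset.range k, if replenishCount q T Q n i < m then
        ((if onHand q T Q n i < cycleLoad q T n i then (1 : ℝ) else 0) -
          (v (onHand q T Q n (i + 1)) - v (onHand q T Q n i))) else 0) =
        replenishCount q T Q n j - (v (onHand q T Q n j) - v Q) ∧
      (replenishCount q T Q n k < m → j = k) := by
  induction k with
  | zero => exact ⟨0, by simp [replenishCount], by simp [replenishCount, onHand], fun _ => rfl⟩
  | succ k ih =>
    obtain ⟨j, h1, h2, h3⟩ := ih
    rw [Finset.sum_range_succ, h2]
    by_cases h : replenishCount q T Q n k < m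
    · have hs := replenishCount_succ (q := q) (T := T) (Q := Q) (n := n) k
      refine ⟨k + 1, ?_, ?_, fun _ => rfl⟩
      · rw [hs]; split_ifs <;> omega
      · rw [if_pos h, h3 h, hs]
        push_cast
        ring
    · refine ⟨j, h1, by rw [if_neg h, add_zero], fun h' => ?_⟩
      have := replenishCount_mono (q := q) (T := T) (Q := Q) (n := n) (Nat.le_succ k)
      simp only [Nat.succ_eq_add_one] at this
      omega

/-- Before the `m`-th replenishment, each cycle brings on average `1 / M_G(Q)` replenishments after
compensation by the potential. The total is pathwise at most `m` plus a bounded term, so the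
expected number of such cycles is finite. -/
theorem IsPoissonProcess.summable_replenishCount_lt (hN : IsPoissonProcess N r P) (hr : 0 < r)
    (hq : 0 < q) (hT : 0 < T) (m : ℕ) :
    Summable fun k => P.real {ω | replenishCount q T Q (fun s => N s ω) k < m} := by
  have hμ : 0 < r * T := mul_pos hr hT
  have hM : 0 < renewalFun (r * T) q Q := one_pos.trans_le (one_le_renewalFun hμ hq Q)
  -- Charge `1` per replenishment and refund `1 / M_G(Q)` per dispatch: the average cost vanishes,
  -- so the cycle length disappears from the mean-zero identity.
  set c : CostParams := ⟨1, 0, -(1 / renewalFun (r * T) q Q), 0, 0, 0⟩ with hc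
  have hAC : averageCost c r T q Q = 0 := by
    have h1 := truncMean_pos hμ hq
    simp only [averageCost, hc]
    field_simp
    ring
  set v := potential c r T q Q with hv
  set V := ∑ j ∈ Finset.range (Q + 1), |v j|
  set A : ℕ → Set Ω := fun k => {ω | replenishCount q T Q (fun s => N s ω) k < m} with hA
  have hAm : ∀ k, MeasurableSet (A k) := fun k => (hN.isDispatchEvent_replenishCount_lt m k).1
  set X : ℕ → Ω → ℝ := fun k ω =>
    (if onHand q T Q (fun s => N s ω) k < cycleLoad q T (fun s => N s ω) k then (1 : ℝ) else 0) -
      (v (onHand q T Q (fun s => N s ω) (k + 1)) - v (onHand q T Q (fun s => N s ω) k)) with hX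
  have hXC : ∀ k ω, cycleCost c q T Q (fun s => N s ω) k -
      averageCost c r T q Q * cycleLength q T (fun s => N s ω) k -
      (v (onHand q T Q (fun s => N s ω) (k + 1)) - v (onHand q T Q (fun s => N s ω) k)) =
      X k ω - 1 / renewalFun (r * T) q Q := by
    intro k ω
    rw [hAC, cycleCost, dispatchCost_eq]
    simp only [hX, hc]
    ring
  have hXi : ∀ k, Integrable (X k) P := by
    intro k
    have h1 := ((hN.integrable_cycleCost (Q := Q) hq hT c k).sub
      ((hN.integrable_comp_onHand (q := q) (T := T) (Q := Q) v (k + 1)).sub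
      (hN.integrable_comp_onHand (q := q) (T := T) (Q := Q) v k))).add
      (integrable_const (1 / renewalFun (r * T) q Q))
    refine h1.congr (Eventually.of_forall fun ω => ?_)
    have h2 := hXC k ω
    rw [hAC] at h2
    simp only [Pi.add_apply, Pi.sub_apply]
    linarith
  have hP : ∀ k, P.real (A k) = renewalFun (r * T) q Q * ∫ ω, (A k).indicator (X k) ω ∂P := by
    intro k
    have h := hN.setIntegral_cycleCost_sub (Q := Q) hr hq hT c
      (hN.isDispatchEvent_replenishCount_lt (Q := Q) m k)
    simp only [← hv, hXC] at h
    rw [integral_sub (hXi k).integrableOn (integrable_const _)] at h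
    rw [integral_indicator (hAm k)]
    simp only [integral_const, measureReal_restrict_apply_univ, smul_eq_mul] at h
    rw [sub_eq_zero.1 h]
    field_simp
    rfl
  refine summable_of_sum_range_le (c := renewalFun (r * T) q Q * (m + (V + V)))
    (fun _ => measureReal_nonneg) fun n => ?_
  have hi : ∀ k ∈ Finset.range n, Integrable ((A k).indicator (X k)) P :=
    fun k _ => (hXi k).indicator (hAm k)
  change ∑ k ∈ Finset.range n, P.real (A k) ≤ _
  simp only [hP]
  rw [← Finset.mul_sum, ← integral_finsetSum _ hi]
  gcongr
  calc ∫ ω, ∑ k ∈ Finset.range n, (A k).indicator (X k) ω ∂P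
      ≤ ∫ _, ((m : ℝ) + (V + V)) ∂P := by
        refine integral_mono (integrable_finsetSum _ hi) (integrable_const _) fun ω => ?_
        obtain ⟨j, h1, h2, _⟩ := exists_sum_replenish_eq (q := q) (T := T) (Q := Q) v
          (fun s => N s ω) m n
        have h3 : ∑ k ∈ Finset.range n, (A k).indicator (X k) ω =
            replenishCount q T Q (fun s => N s ω) j -
              (v (onHand q T Q (fun s => N s ω) j) - v Q) := by
          rw [← h2]
          refine Finset.sum_congr rfl fun k _ => ?_
          by_cases h : replenishCount q T Q (fun s => N s ω) k < m
          · rw [Set.indicator_of_mem (show ω ∈ A k from h), if_pos h]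
          · rw [Set.indicator_of_notMem (show ω ∉ A k from h), if_neg h]
        have h4 : (replenishCount q T Q (fun s => N s ω) j : ℝ) ≤ m := by exact_mod_cast h1
        have h5 := abs_le.1 (abs_comp_onHand_le (q := q) (T := T) (Q := Q) v (fun s => N s ω) j)
        have h6 := abs_le.1 (abs_comp_onHand_le (q := q) (T := T) (Q := Q) v (fun s => N s ω) 0)
        have h7 : onHand q T Q (fun s => N s ω) 0 = Q := rfl
        rw [h7] at h6
        simp only [h3]
        linarith [h5.1, h6.2]
    _ = (m : ℝ) + (V + V) := by simp

/-- Never reaching `m` is contained in every event of a summable series, whose probabilities tend to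
`0`. -/
theorem IsPoissonProcess.ae_replenishCount_unbounded (hN : IsPoissonProcess N r P) (hr : 0 < r)
    (hq : 0 < q) (hT : 0 < T) :
    ∀ᵐ ω ∂P, ∀ m, ∃ k, m ≤ replenishCount q T Q (fun s => N s ω) k := by
  refine ae_all_iff.2 fun m => ?_
  rw [ae_iff, ← measureReal_eq_zero_iff]
  refine le_antisymm (ge_of_tendsto' (hN.summable_replenishCount_lt (Q := Q) hr hq hT
    m).tendsto_atTop_zero fun k => measureReal_mono fun ω hω => ?_) measureReal_nonneg
  rw [Set.mem_ofPred_eq] at hω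
  push Not at hω
  exact hω k

/-- The stock is `Q` at the start and after every replenishment, so the potential terms of Wald's
identity cancel. -/
theorem IsPoissonProcess.integral_totalCost_replenishTime (hN : IsPoissonProcess N r P)
    (hr : 0 < r) (hq : 0 < q) (hT : 0 < T) (c : CostParams) (m : ℕ) :
    Integrable (fun ω => (replenishTime q T Q (fun s => N s ω) m : ℝ)) P ∧
    Integrable (fun ω => totalCost c q T Q (fun s => N s ω)
      (replenishTime q T Q (fun s => N s ω) m)) P ∧
    ∫ ω, totalCost c q T Q (fun s => N s ω) (replenishTime q T Q (fun s => N s ω) m) ∂P =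
      averageCost c r T q Q * ∫ ω, (replenishTime q T Q (fun s => N s ω) m : ℝ) ∂P := by
  have hu := hN.ae_replenishCount_unbounded (Q := Q) hr hq hT
  obtain ⟨i1, i2, _, e⟩ := hN.integral_sum_cycleCost (Q := Q) hr hq hT c
    (κ := fun ω => replenishIndex q T Q (fun s => N s ω) m)
    (fun k => hN.isDispatchEvent_replenishCount_lt (Q := Q) m k)
    (hu.mono fun ω hω k => lt_replenishIndex_iff hω m k)
    (hN.summable_replenishCount_lt hr hq hT m)
  have h1 : ∫ ω, potential c r T q Q (onHand q T Q (fun s => N s ω)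
      (replenishIndex q T Q (fun s => N s ω) m)) ∂P = potential c r T q Q Q := by
    rw [integral_congr_ae (g := fun _ => potential c r T q Q Q)
      (hu.mono fun ω hω => by simp only [onHand_replenishIndex hω m])]
    simp
  have h2 : ∀ ω, totalCost c q T Q (fun s => N s ω) (replenishTime q T Q (fun s => N s ω) m) =
      ∑ k ∈ Finset.range (replenishIndex q T Q (fun s => N s ω) m),
        cycleCost c q T Q (fun s => N s ω) k := fun ω =>
    totalCost_dispatchTime (hN.isDemandPath ω) hq hT _
  rw [h1, sub_self, add_zero] at e
  simp only [h2]
  exact ⟨i2, i1, e⟩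

theorem IsPoissonProcess.replenishCycle (hN : IsPoissonProcess N r P)
    (hr : 0 < r) (hq : 0 < q) (hT : 0 < T) (c : CostParams) (m : ℕ) :
    Integrable (fun ω => replenishCycleLength q T Q (fun t => N t ω) m) P ∧
    0 < (∫ ω, replenishCycleLength q T Q (fun t => N t ω) m ∂P) ∧
    Integrable (fun ω => replenishCycleCost c q T Q (fun t => N t ω) m) P ∧
    (∫ ω, replenishCycleCost c q T Q (fun t => N t ω) m ∂P) /
      (∫ ω, replenishCycleLength q T Q (fun t => N t ω) m ∂P) = averageCost c r T q Q := by
  obtain ⟨l1, c1, e1⟩ := hN.integral_totalCost_replenishTime (Q := Q) hr hq hT c m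
  obtain ⟨l2, c2, e2⟩ := hN.integral_totalCost_replenishTime (Q := Q) hr hq hT c (m + 1)
  have hl : Integrable (fun ω => replenishCycleLength q T Q (fun t => N t ω) m) P := l2.sub l1
  have hpos : ∀ᵐ ω ∂P, 0 < replenishCycleLength q T Q (fun t => N t ω) m := by
    filter_upwards [hN.ae_replenishCount_unbounded (Q := Q) hr hq hT] with ω hω
    exact sub_pos.2 (NNReal.coe_lt_coe.2 (dispatchTime_strictMono (hN.isDemandPath ω) hq hT
      (replenishIndex_lt_succ hω m)))
  have hlpos : 0 < ∫ ω, replenishCycleLength q T Q (fun t => N t ω) m ∂P := by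
    refine (integral_nonneg_of_ae (hpos.mono fun ω h => h.le)).lt_of_ne' fun h0 => ?_
    rw [integral_eq_zero_iff_of_nonneg_ae (hpos.mono fun ω h => h.le) hl] at h0
    obtain ⟨ω, h1, h2⟩ := (hpos.and h0).exists
    exact h1.ne' h2
  refine ⟨hl, hlpos, c2.sub c1, ?_⟩
  rw [div_eq_iff hlpos.ne']
  simp only [replenishCycleCost, replenishCycleLength]
  rw [integral_sub c2 c1, integral_sub l2 l1, e1, e2]
  ring

end ReplenishmentCycles
theorem mainTheorem3 {Ω : Type*} [MeasurableSpace Ω] (P : Measure Ω) [IsProbabilityMeasure P]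
    (N : ℝ≥0 → Ω → ℕ) (r : ℝ≥0) (hr : 0 < r) (hN : IsPoissonProcess N r P)
    (c : CostParams) (q : ℕ) (hq : 0 < q) (T : ℝ≥0) (hT : 0 < T) (Q : ℕ) (hQ : 0 < Q) :
    -- the series and the quotients in the formula are meaningful
    (∀ i, Summable fun k => convPMF (r * T) q k i) ∧
    (∀ i, Summable fun k => convCDF (r * T) q k i) ∧
    0 < truncMean (r * T) q ∧ 0 < renewalFun (r * T) q Q ∧
    ∃ AC : ℝ,
      AC = r * (c.cR + c.cD)
          + r * c.AR / (renewalFun (r * T) q Q * truncMean (r * T) q)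
          + r * c.AD / truncMean (r * T) q
          + c.h * (∑ i ∈ Finset.range (Q + 1), ((Q : ℝ) - (i : ℝ)) * renewalMass (r * T) q i)
              / renewalFun (r * T) q Q
          + c.w * truncFactorialMoment (r * T) q / (2 * truncMean (r * T) q) ∧
      -- the expected cost of a replenishment cycle divided by its expected length
      (∀ m,
        Integrable (fun ω => replenishCycleLength q T Q (fun t => N t ω) m) P ∧
        0 < (∫ ω, replenishCycleLength q T Q (fun t => N t ω) m ∂P) ∧
        Integrable (fun ω => replenishCycleCost c q T Q (fun t => N t ω) m) P ∧
        (∫ ω, replenishCycleCost c q T Q (fun t => N t ω) m ∂P) /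
          (∫ ω, replenishCycleLength q T Q (fun t => N t ω) m ∂P) = AC) ∧
      -- the expected long-run average cost per time unit
      (∀ t, Integrable (fun ω => totalCost c q T Q (fun s => N s ω) t) P) ∧
      Tendsto (fun t : ℝ≥0 => (∫ ω, totalCost c q T Q (fun s => N s ω) t ∂P) / (t : ℝ))
        atTop (𝓝 AC) := by

  have hμ : 0 < r * T := mul_pos hr hT
  exact ⟨summable_convPMF hμ hq, summable_convCDF hμ hq, truncMean_pos hμ hq,
    one_pos.trans_le (one_le_renewalFun hμ hq Q), averageCost c r T q Q, rfl,
    hN.replenishCycle hr hq hT c, (hN.integrable_totalCost hr hq hT c).1,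
    hN.tendsto_totalCost_div hr hq hT c⟩
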